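/- Let $\mathbb{R}^{n+1}_+=\{(x,t)\in\mathbb{R}^n\times\mathbb{R}: t>0\}$, $n\ge 1$. For an integer $m\ge1$ write $D^m u=\nabla\Delta^{\frac{m-1}{2}}u$ if $m$ is odd and $D^m u=\Delta^{\frac m2}u$ if $m$ is even, and for real $p,\alpha,\beta$ put $$p_m^*=p_m^*(\alpha,\beta):=\frac{p(n+1+\beta)}{n+1+\alpha-mp}.$$ Let $\mathcal T_m$ be the set of real functions in $C_0^\infty(\overline{\mathbb{R}^{n+1}_+})$ satisfying the boundary conditions $$\lim_{t\to0^+}\frac{\partial \Delta^{j}\varphi(x,t)}{\partial t}=0\quad\text{for all }x\in\mathbb{R}^n\text{ and all integers }0\le j<\lfloor m/2\rfloor,$$ that is, $j=0,\dots,\frac{m-1}2-1$ if $m$ is odd (no condition if $m=1$) and $j=0,\dots,\frac m2-1$ if $m$ is even; $\mathcal T_m$ contains $C_0^\infty(\mathbb{R}^{n+1}_+)$. Let $W^{m,p}_\alpha(\mathbb{R}^{n+1}_+)$ be the completion of $\mathcal T_m$ with respect to $\int_{\mathbb{R}^{n+1}_+}t^{\alpha}|D^m\varphi|^p\,dx\,dt$,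 realized as the space of those $u\in L^1_{loc}(\mathbb{R}^{n+1}_+)$ whose weak derivative $D^mu$ exists with $\int_{\mathbb{R}^{n+1}_+} t^\alpha|D^mu|^p\,dx\,dt<\infty$ and for which there are $\varphi_i\in\mathcal T_m$ with $\varphi_i\to u$ in $L^1_{loc}(\mathbb{R}^{n+1}_+)$ and $\int_{\mathbb{R}^{n+1}_+}t^{\alpha}|D^m\varphi_i-D^mu|^p\,dx\,dt\to0$. **Theorem 1.10.** (First order.) Let $n\ge1$, $1<p<n+1$, $p<p^*=p^*(\alpha_1,\beta_1):=\frac{p(n+1+\beta_1)}{n+1+\alpha_1-p}$, and $$\frac{pn}{p^*}-(n+1-p)<\alpha_1<p-1,\qquad -1<\beta_1\le\frac{\alpha_1(n+1)}{n+1-p}.$$ Then there exists a constant $S=S(n+1,p,\alpha_1,\beta_1)>0$ such that $$\Big(\int_{\mathbb{R}^{n+1}_+}t^{\beta_1}|u|^{p^*}dx\,dt\Big)^{\frac p{p^*}}\le S\int_{\mathbb{R}^{n+1}_+}t^{\alpha_1}|\nabla u|^p\,dx\,dt\qquad\text{for all }u\in W^{1,p}_{\alpha_1}(\mathbb{R}^{n+1}_+).$$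 (Higher order.) Let $n\ge1$, let $m$ be a positive integer with $mp<n$, and let $1<p<p_m^*=p_m^*(\alpha_m,\beta_m)$, $$\frac{pn}{p_m^*}-(n+1-mp)<\alpha_m<p-1,\qquad -1<\beta_m\le\frac{\alpha_m(n+1)}{n+1-mp}.$$ Then there exists a constant $C=C(n+1,p,\alpha_m,\beta_m,m)>0$ such that for all $u\in W^{m,p}_{\alpha_m}(\mathbb{R}^{n+1}_+)$: (i) if $m$ is odd, $$\Big(\int_{\mathbb{R}^{n+1}_+}t^{\beta_m}|u|^{p_m^*}dx\,dt\Big)^{\frac p{p_m^*}}\le C\int_{\mathbb{R}^{n+1}_+}t^{\alpha_m}\big|\nabla\Delta^{\frac{m-1}2}u\big|^p\,dx\,dt;$$ (ii) if $m$ is even, $$\Big(\int_{\mathbb{R}^{n+1}_+}t^{\beta_m}|u|^{p_m^*}dx\,dt\Big)^{\frac p{p_m^*}}\le C\int_{\mathbb{R}^{n+1}_+}t^{\alpha_m}\big|\Delta^{\frac m2}u\big|^p\,dx\,dt.$$ -/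

import Mathlib

open MeasureTheory Filter Topology Laplacian Gradient
open scoped ContDiff ENNReal

noncomputable section

/-- Euclidean space `ℝ^(n+1) = ℝⁿ × ℝ`; the last coordinate is the variable `t`. -/
abbrev HalfAmbient (n : ℕ) : Type := EuclideanSpace ℝ (Fin (n + 1))

/-- The last coordinate `t` of a point `(x, t)`. -/
def height {n : ℕ} (X : HalfAmbient n) : ℝ := X (Fin.last n)

/-- The unit vector in the direction of `t`. -/
def eLast (n : ℕ) : HalfAmbient n := EuclideanSpace.single (Fin.last n) 1

/-- The open upper half space `{(x, t) : t > 0}`. -/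
def halfSpace (n : ℕ) : Set (HalfAmbient n) := {X | 0 < height X}

/-- The weighted integral `∫_{t > 0} t ^ a * ‖F‖ ^ q`, with values in `[0, ∞]`. -/
def wInt {n : ℕ} {V : Type*} [NormedAddCommGroup V] (a q : ℝ) (F : HalfAmbient n → V) : ℝ≥0∞ :=
  ∫⁻ X in halfSpace n, ENNReal.ofReal (height X ^ a) * ‖F X‖ₑ ^ q

/-- The iterated Laplacian `Δ^k`. -/
def lapPow {n : ℕ} (k : ℕ) (f : HalfAmbient n → ℝ) : HalfAmbient n → ℝ :=
  (fun g : HalfAmbient n → ℝ => Δ g)^[k] f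

/-- The boundary conditions `lim_{t → 0+} ∂_t Δ^j f (x, t) = 0` for all `x ∈ ℝⁿ` and `j < r`. -/
def NeumannCond {n : ℕ} (r : ℕ) (f : HalfAmbient n → ℝ) : Prop :=
  ∀ j < r, ∀ X : HalfAmbient n, height X = 0 →
    Tendsto (fun t : ℝ => fderiv ℝ (lapPow j f) (X + t • eLast n) (eLast n)) (𝓝[>] 0) (𝓝 0)

/-- The test functions: smooth functions with compact support in the closed half space (each is
represented by a smooth compactly supported extension to `ℝ^(n+1)`), subject to the first `r`
boundary conditions. There are none for `r = 0`. All smooth functions with compact support in the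
open half space belong to this class, see `isTest_of_tsupport_subset`. -/
structure IsTest {n : ℕ} (r : ℕ) (φ : HalfAmbient n → ℝ) : Prop where
  smooth : ContDiff ℝ ∞ φ
  compact : HasCompactSupport φ
  neumann : NeumannCond r φ

theorem lapPow_eventuallyEq_zero {n : ℕ} (k : ℕ) {f : HalfAmbient n → ℝ} {X : HalfAmbient n}
    (h : f =ᶠ[𝓝 X] 0) : lapPow k f =ᶠ[𝓝 X] 0 := by
  induction k with
  | zero => simpa [lapPow] using h
  | succ k ih =>
    have h1 := InnerProductSpace.laplacian_congr_nhds ih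
    have h2 : (Δ (0 : HalfAmbient n → ℝ)) = 0 := by
      have := InnerProductSpace.laplacian_const (E := HalfAmbient n) (c := (0 : ℝ))
      exact this
    rw [h2] at h1
    unfold lapPow
    rw [Function.iterate_succ_apply']
    exact h1

theorem isTest_of_tsupport_subset {n : ℕ} (r : ℕ) {φ : HalfAmbient n → ℝ} (h1 : ContDiff ℝ ∞ φ)
    (h2 : HasCompactSupport φ) (h3 : tsupport φ ⊆ halfSpace n) : IsTest r φ := by
  refine ⟨h1, h2, fun j _ X hX => ?_⟩
  have hmem : X ∉ tsupport φ := fun h => by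
    have h4 : 0 < height X := h3 h
    rw [hX] at h4
    exact lt_irrefl _ h4
  have h0 : lapPow j φ =ᶠ[𝓝 X] 0 :=
    lapPow_eventuallyEq_zero j (notMem_tsupport_iff_eventuallyEq.mp hmem)
  have hd := h0.fderiv (𝕜 := ℝ)
  have hc : Tendsto (fun t : ℝ => X + t • eLast n) (𝓝[>] 0) (𝓝 X) := by
    have : Continuous (fun t : ℝ => X + t • eLast n) := by fun_prop
    have h := this.tendsto 0
    simp only [zero_smul, add_zero] at h
    exact h.mono_left nhdsWithin_le_nhds
  have he := hc.eventually hd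
  refine tendsto_const_nhds.congr' ?_
  filter_upwards [he] with t ht
  rw [ht]
  simp

/-- `g` is the weak `Δ^k` of `u` in the open half space. -/
structure IsWeakLap {n : ℕ} (k : ℕ) (u g : HalfAmbient n → ℝ) : Prop where
  locInt : LocallyIntegrableOn g (halfSpace n)
  eq : ∀ ψ : HalfAmbient n → ℝ, ContDiff ℝ ∞ ψ → HasCompactSupport ψ → tsupport ψ ⊆ halfSpace n →
    ∫ X in halfSpace n, ψ X * g X = ∫ X in halfSpace n, u X * lapPow k ψ X

/-- `G` is the weak `∇ Δ^k` of `u` in the open half space; for `k = 0` it is the weak gradient. -/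
structure IsWeakGradLap {n : ℕ} (k : ℕ) (u : HalfAmbient n → ℝ) (G : HalfAmbient n → HalfAmbient n) :
    Prop where
  locInt : LocallyIntegrableOn G (halfSpace n)
  eq : ∀ ψ : HalfAmbient n → ℝ, ContDiff ℝ ∞ ψ → HasCompactSupport ψ → tsupport ψ ⊆ halfSpace n →
    ∫ X in halfSpace n, ψ X • G X = -∫ X in halfSpace n, u X • ∇ (lapPow k ψ) X

/-- Convergence `φ i → u` in `L¹_loc` of the open half space. -/
def TendstoL1Loc {n : ℕ} (φ : ℕ → HalfAmbient n → ℝ) (u : HalfAmbient n → ℝ) : Prop :=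
  ∀ K : Set (HalfAmbient n), IsCompact K → K ⊆ halfSpace n →
    Tendsto (fun i => ∫⁻ X in K, ‖φ i X - u X‖ₑ) atTop (𝓝 0)

/-- The space `W_a^{m,p}` with `m = 2k+1`, as a space of functions on the open half space: the
completion of the test functions, with the boundary conditions `∂_t Δ^j = 0`, `j < k`, for the norm
given by `∫ t ^ a * |∇ Δ^k φ| ^ p`. -/
def MemSobolevOdd {n : ℕ} (k : ℕ) (a p : ℝ) (u : HalfAmbient n → ℝ) : Prop :=
  LocallyIntegrableOn u (halfSpace n) ∧
  ∃ G : HalfAmbient n → HalfAmbient n, IsWeakGradLap k u G ∧ wInt a p G < ⊤ ∧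
    ∃ φ : ℕ → HalfAmbient n → ℝ, (∀ i, IsTest k (φ i)) ∧ TendstoL1Loc φ u ∧
      Tendsto (fun i => wInt a p (fun X => ∇ (lapPow k (φ i)) X - G X)) atTop (𝓝 0)

/-- The space `W_a^{m,p}` with `m = 2k`, as a space of functions on the open half space: the
completion of the test functions, with the boundary conditions `∂_t Δ^j = 0`, `j < k`, for the norm
given by `∫ t ^ a * |Δ^k φ| ^ p`. -/
def MemSobolevEven {n : ℕ} (k : ℕ) (a p : ℝ) (u : HalfAmbient n → ℝ) : Prop :=
  LocallyIntegrableOn u (halfSpace n) ∧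
  ∃ g : HalfAmbient n → ℝ, IsWeakLap k u g ∧ wInt a p g < ⊤ ∧
    ∃ φ : ℕ → HalfAmbient n → ℝ, (∀ i, IsTest k (φ i)) ∧ TendstoL1Loc φ u ∧
      Tendsto (fun i => wInt a p (fun X => lapPow k (φ i) X - g X)) atTop (𝓝 0)

/-- The exponent `p (n + 1 + b) / (n + 1 + a - m p)`. -/
def critExp (n m : ℕ) (p a b : ℝ) : ℝ := p * (n + 1 + b) / (n + 1 + a - m * p)

/-- The conditions on the exponents for the inequality of order `m`. -/
structure ExpCond (n m : ℕ) (p a b : ℝ) : Prop where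
  one_lt : 1 < p
  lt_critExp : p < critExp n m p a b
  lower : p * n / critExp n m p a b - (n + 1 - m * p) < a
  upper : a < p - 1
  neg_one_lt : -1 < b
  le : b ≤ a * (n + 1) / (n + 1 - m * p)

end

/-
A test function is dominated on the half space by a Riesz potential of its derivative. For the
gradient, integrate along all rays from `X` pointing up, so that only values in the half space are
used. For the Laplacian, the vanishing normal derivative makes the even reflection in `t` a `C¹`
function with the reflected Laplacian as its distributional Laplacian, so the Newtonian potential
represents it, and reflecting back only increases distances to points of the half space.

The weighted Hardy-Littlewood-Sobolev inequality for the kernel `t ^ b * s ^ (-a) * ‖X - Y‖ ^ (-l)`,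
with `t`, `s` the heights of `X`, `Y`, is proved by splitting it at `‖X - Y‖ = t / 2`. Closer to the
diagonal `t` and `s` are comparable and `t ^ (b - a) ≤ ‖X - Y‖ ^ (b - a)`, which leaves an
unweighted Riesz kernel; farther away a Schur test applies.

The inequality of order `m` follows by iterating these two estimates along linearly interpolated
exponents, and Fatou's lemma carries it from test functions to the completion.
-/

theorem ofReal_rpow_mul_ofReal_rpow {a x y : ℝ} (ha : 0 < a) :
    ENNReal.ofReal (a ^ x) * ENNReal.ofReal (a ^ y) = ENNReal.ofReal (a ^ (x + y)) := by
  rw [← ENNReal.ofReal_mul (by positivity), Real.rpow_add ha]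

section HardyLittlewoodSobolev

variable {E : Type*} [NormedAddCommGroup E] [NormedSpace ℝ E] [FiniteDimensional ℝ E]
  [MeasurableSpace E] [BorelSpace E] (μ : Measure E) [μ.IsAddHaarMeasure]

theorem lintegral_eq_lintegral_comp_smul {R : ℝ} (hR : 0 < R) (F : E → ℝ≥0∞) :
    ∫⁻ Z, F Z ∂μ = ENNReal.ofReal (R ^ (Module.finrank ℝ E : ℝ)) * ∫⁻ W, F (R • W) ∂μ := by
  have e : MeasurableEmbedding (fun W : E => R • W) :=
    (Homeomorph.smulOfNeZero R hR.ne').measurableEmbedding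
  have h := e.lintegral_map (μ := μ) F
  rw [Measure.map_addHaar_smul μ hR.ne', lintegral_smul_measure] at h
  rw [← h, smul_eq_mul, ← mul_assoc, ← ENNReal.ofReal_mul (by positivity), Real.rpow_natCast,
    abs_of_pos (by positivity), mul_inv_cancel₀ (by positivity), ENNReal.ofReal_one, one_mul]

theorem setLIntegral_norm_sub_rpow (X : E) {R : ℝ} (hR : 0 < R) (l : ℝ) {s : Set ℝ}
    (hs : MeasurableSet s) :
    ∫⁻ Y in {Y | ‖X - Y‖ ∈ s}, ENNReal.ofReal (‖X - Y‖ ^ (-l)) ∂μ =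
      ENNReal.ofReal (R ^ ((Module.finrank ℝ E : ℝ) - l)) *
        ∫⁻ Z in {Z | R * ‖Z‖ ∈ s}, ENNReal.ofReal (‖Z‖ ^ (-l)) ∂μ := by
  classical
  have measurable_radial {f : E → ℝ} (hf : Measurable f) : MeasurableSet {Y | f Y ∈ s} := hf hs
  rw [← lintegral_indicator (measurable_radial (by fun_prop)),
    ← lintegral_indicator (measurable_radial (by fun_prop))]
  calc ∫⁻ Y, {Y | ‖X - Y‖ ∈ s}.indicator (fun Y => ENNReal.ofReal (‖X - Y‖ ^ (-l))) Y ∂μ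
      = ∫⁻ Z, {Z | ‖Z‖ ∈ s}.indicator (fun Z => ENNReal.ofReal (‖Z‖ ^ (-l))) Z ∂μ :=
        lintegral_sub_left_eq_self
          (fun Z => {Z | ‖Z‖ ∈ s}.indicator (fun Z => ENNReal.ofReal (‖Z‖ ^ (-l))) Z) X
    _ = _ := by
      rw [lintegral_eq_lintegral_comp_smul μ hR, sub_eq_add_neg, ← ofReal_rpow_mul_ofReal_rpow hR,
        mul_assoc]
      congr 1
      rw [← lintegral_const_mul' _ _ ENNReal.ofReal_ne_top]
      refine lintegral_congr fun Z => ?_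
      simp only [Set.indicator_apply, Set.mem_ofPred_eq, norm_smul, Real.norm_of_nonneg hR.le]
      split_ifs
      · rw [← ENNReal.ofReal_mul (by positivity), Real.mul_rpow hR.le (norm_nonneg _)]
      · rw [mul_zero]

theorem setLIntegral_norm_lt_one_rpow_ne_top [Nontrivial E] {l : ℝ}
    (hl : l < Module.finrank ℝ E) :
    ∫⁻ Z in {Z | ‖Z‖ < 1}, ENNReal.ofReal (‖Z‖ ^ (-l)) ∂μ ≠ ⊤ := by
  have h := integrableOn_ball_of_norm_le_rpow (μ := μ) Module.finrank_pos
    (f := fun Z : E => ‖Z‖ ^ (-l)) (C := 1) (r := 1) hl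
    (Eventually.of_forall fun x => by rw [one_mul, Real.norm_of_nonneg (by positivity)])
    (Measurable.aestronglyMeasurable (by fun_prop))
  rw [← ball_zero_eq]
  exact h.setLIntegral_lt_top.ne

theorem setLIntegral_one_le_norm_rpow_ne_top {l : ℝ} (hl : (Module.finrank ℝ E : ℝ) < l) :
    ∫⁻ Z in {Z | 1 ≤ ‖Z‖}, ENNReal.ofReal (‖Z‖ ^ (-l)) ∂μ ≠ ⊤ := by
  have hl0 : 0 ≤ l := (Nat.cast_nonneg _).trans hl.le
  have hfin := ENNReal.mul_ne_top (ENNReal.ofReal_ne_top (r := 2 ^ l))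
    (finite_integral_one_add_norm (μ := μ) hl).ne
  refine ne_top_of_le_ne_top hfin ?_
  rw [← lintegral_const_mul' _ _ ENNReal.ofReal_ne_top]
  refine (setLIntegral_mono (by fun_prop) fun Z (hZ : 1 ≤ ‖Z‖) => ?_).trans
    (setLIntegral_le_lintegral _ _)
  rw [← ENNReal.ofReal_mul (by positivity)]
  refine ENNReal.ofReal_le_ofReal ?_
  calc ‖Z‖ ^ (-l) = 2 ^ l * (2 * ‖Z‖) ^ (-l) := by
        rw [Real.mul_rpow (by norm_num) (by positivity), ← mul_assoc,
          ← Real.rpow_add (by norm_num), add_neg_cancel, Real.rpow_zero, one_mul]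
    _ ≤ 2 ^ l * (1 + ‖Z‖) ^ (-l) := by
        gcongr 2 ^ l * ?_
        exact Real.rpow_le_rpow_of_nonpos (by positivity) (by linarith) (neg_nonpos.2 hl0)

theorem setLIntegral_riesz_mul_le_of_near (X : E) {R l θ : ℝ} (hR : 0 < R) (hθ : 0 ≤ θ)
    {M : ℝ≥0∞} {h : E → ℝ≥0∞} (hM : ∀ Y, h Y ≤ M) :
    ∫⁻ Y in {Y | ‖X - Y‖ < R}, ENNReal.ofReal (‖X - Y‖ ^ (-l)) * h Y ^ θ ∂μ ≤
      ENNReal.ofReal (R ^ ((Module.finrank ℝ E : ℝ) - l)) *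
        (∫⁻ Z in {Z | ‖Z‖ < 1}, ENNReal.ofReal (‖Z‖ ^ (-l)) ∂μ) * M ^ θ := by
  have hset : {Z : E | ‖Z‖ < 1} = {Z | R * ‖Z‖ ∈ Set.Iio R} := by
    ext Z; simp only [Set.mem_ofPred_eq, Set.mem_Iio, mul_lt_iff_lt_one_right hR]
  rw [hset, ← setLIntegral_norm_sub_rpow μ X hR l measurableSet_Iio,
    ← lintegral_mul_const _ (by fun_prop)]
  refine lintegral_mono fun Y => ?_
  gcongr
  exact hM Y

theorem setLIntegral_riesz_mul_le_of_far (X : E) {R l θ : ℝ} (hR : 0 < R) (hθ0 : 0 ≤ θ)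
    (hθ1 : θ < 1) {h : E → ℝ≥0∞} (hm : Measurable h) (hint : ∫⁻ Y, h Y ∂μ ≤ 1) :
    ∫⁻ Y in {Y | R ≤ ‖X - Y‖}, ENNReal.ofReal (‖X - Y‖ ^ (-l)) * h Y ^ θ ∂μ ≤
      (ENNReal.ofReal (R ^ ((Module.finrank ℝ E : ℝ) - l / (1 - θ))) *
        ∫⁻ Z in {Z | 1 ≤ ‖Z‖}, ENNReal.ofReal (‖Z‖ ^ (-(l / (1 - θ)))) ∂μ) ^ (1 - θ) := by
  have hθ' : 0 < 1 - θ := by linarith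
  have hset : {Z : E | 1 ≤ ‖Z‖} = {Z | R * ‖Z‖ ∈ Set.Ici R} := by
    ext Z; simp only [Set.mem_ofPred_eq, Set.mem_Ici, le_mul_iff_one_le_right hR]
  rw [hset, ← setLIntegral_norm_sub_rpow μ X hR _ measurableSet_Ici]
  have hpow : ∀ Y, ENNReal.ofReal (‖X - Y‖ ^ (-l)) =
      ENNReal.ofReal (‖X - Y‖ ^ (-(l / (1 - θ)))) ^ (1 - θ) := fun Y => by
    rw [ENNReal.ofReal_rpow_of_nonneg (by positivity) hθ'.le, ← Real.rpow_mul (by positivity),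
      neg_mul, div_mul_cancel₀ _ hθ'.ne']
  simp_rw [hpow]
  refine (ENNReal.lintegral_mul_norm_pow_le (by fun_prop) (by fun_prop) hθ'.le hθ0
    (by ring)).trans (mul_le_of_le_one_right' ?_)
  exact ENNReal.rpow_le_one ((setLIntegral_le_lintegral _ _).trans hint) hθ0

theorem exists_lintegral_riesz_mul_le [Nontrivial E] {κ θ : ℝ} (hκ : κ < 1) (hθ0 : 0 < θ)
    (hθ1 : θ < 1) (hκθ : 1 - θ < κ) :
    ∃ C : ℝ≥0∞, C ≠ ⊤ ∧ ∀ (X : E) (M : ℝ≥0∞) (h : E → ℝ≥0∞), Measurable h → (∀ Y, h Y ≤ M) →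
      ∫⁻ Y, h Y ∂μ ≤ 1 →
      ∫⁻ Y, ENNReal.ofReal (‖X - Y‖ ^ (-((Module.finrank ℝ E : ℝ) * κ))) * h Y ^ θ ∂μ ≤
        C * M ^ (κ - 1 + θ) := by
  set d : ℝ := (Module.finrank ℝ E : ℝ) with hd
  have hd0 : 0 < d := by rw [hd]; exact_mod_cast Module.finrank_pos
  have hθ' : 0 < 1 - θ := by linarith
  set near := ∫⁻ Z in {Z : E | ‖Z‖ < 1}, ENNReal.ofReal (‖Z‖ ^ (-(d * κ))) ∂μ
  set far := ∫⁻ Z in {Z : E | 1 ≤ ‖Z‖}, ENNReal.ofReal (‖Z‖ ^ (-(d * κ / (1 - θ)))) ∂μ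
  have hnear : near ≠ ⊤ := setLIntegral_norm_lt_one_rpow_ne_top μ (mul_lt_of_lt_one_right hd0 hκ)
  have hfar : far ≠ ⊤ := setLIntegral_one_le_norm_rpow_ne_top μ (by
    rw [lt_div_iff₀ hθ']; exact mul_lt_mul_of_pos_left hκθ hd0)
  refine ⟨near + far ^ (1 - θ) + 1, by simp [hnear, hfar, ENNReal.rpow_eq_top_iff, hθ1.le],
    fun X M h hm hM hint => ?_⟩
  rcases eq_or_ne M 0 with rfl | hM0
  · have : ∀ Y, h Y = 0 := fun Y => le_antisymm (hM Y) bot_le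
    simp [this, hθ0]
  rcases eq_or_ne M ⊤ with rfl | hMt
  · rw [ENNReal.top_rpow_of_pos (by linarith), ENNReal.mul_top (by simp)]; exact le_top
  obtain ⟨m, hm0, rfl⟩ : ∃ m : ℝ, 0 < m ∧ M = ENNReal.ofReal m :=
    ⟨M.toReal, ENNReal.toReal_pos hM0 hMt, (ENNReal.ofReal_toReal hMt).symm⟩
  -- The radius at which the `L∞` bound `m` and the `L¹` bound `1` on `h` contribute equally.
  set R := m ^ (-(1 / d)) with hR
  have hR0 : 0 < R := by positivity
  have hcompl : {Y | ‖X - Y‖ < R}ᶜ = {Y | R ≤ ‖X - Y‖} := by ext; simp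
  rw [← lintegral_add_compl _ (measurableSet_lt (by fun_prop) measurable_const :
    MeasurableSet {Y | ‖X - Y‖ < R}), hcompl]
  calc _ ≤ ENNReal.ofReal (R ^ (d - d * κ)) * near * ENNReal.ofReal m ^ θ +
        (ENNReal.ofReal (R ^ (d - d * κ / (1 - θ))) * far) ^ (1 - θ) :=
        add_le_add (setLIntegral_riesz_mul_le_of_near μ X hR0 hθ0.le hM)
          (setLIntegral_riesz_mul_le_of_far μ X hR0 hθ0.le hθ1 hm hint)
    _ = (near + far ^ (1 - θ)) * ENNReal.ofReal m ^ (κ - 1 + θ) := by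
        have enear : -(1 / d) * (d - d * κ) + θ = κ - 1 + θ := by field_simp; ring
        have efar : -(1 / d) * (d - d * κ / (1 - θ)) * (1 - θ) = κ - 1 + θ := by
          field_simp; ring
        rw [mul_right_comm, ENNReal.mul_rpow_of_nonneg _ _ hθ'.le, hR, ← Real.rpow_mul hm0.le,
          ← Real.rpow_mul hm0.le, ENNReal.ofReal_rpow_of_pos hm0, ENNReal.ofReal_rpow_of_pos hm0,
          ENNReal.ofReal_rpow_of_pos (Real.rpow_pos_of_pos hm0 _), ← Real.rpow_mul hm0.le,
          ofReal_rpow_mul_ofReal_rpow hm0, enear, efar]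
        ring
    _ ≤ _ := mul_le_mul_left le_self_add _

/- On `{f Y ≤ g X}` the inner integral is at most a power of `g X`, which together with `g X ^ η` is
a multiple of `g X` itself. -/
theorem exists_lintegral_riesz_indicator_le [Nontrivial E] {θ η : ℝ} (hθ0 : 0 < θ) (hθ1 : θ < 1)
    (hη0 : 0 ≤ η) (hη1 : η < 1) (hθη : 1 < θ + η) :
    ∃ C : ℝ≥0∞, C ≠ ⊤ ∧ ∀ f g : E → ℝ≥0∞, Measurable f → Measurable g →
      ∫⁻ Y, f Y ∂μ ≤ 1 → ∫⁻ X, g X ∂μ ≤ 1 →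
      ∫⁻ X, ∫⁻ Y, g X ^ η *
        (ENNReal.ofReal (‖X - Y‖ ^ (-((Module.finrank ℝ E : ℝ) * (2 - θ - η)))) *
          {Y | f Y ≤ g X}.indicator f Y ^ θ) ∂μ ∂μ ≤ C := by
  obtain ⟨C, hC, hriesz⟩ := exists_lintegral_riesz_mul_le μ (κ := 2 - θ - η) (by linarith) hθ0 hθ1
    (by linarith)
  refine ⟨C, hC, fun f g hf hg If Ig => ?_⟩
  calc _ ≤ ∫⁻ X, C * g X ∂μ := by
        refine lintegral_mono fun X => ?_
        have htrunc : Measurable ({Y | f Y ≤ g X}.indicator f) :=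
          hf.indicator (measurableSet_le hf measurable_const)
        rw [lintegral_const_mul _ (by fun_prop)]
        calc _ ≤ g X ^ η * (C * g X ^ (2 - θ - η - 1 + θ)) := by
              gcongr
              refine hriesz X (g X) _ htrunc (fun Y => ?_)
                ((lintegral_mono fun Y => Set.indicator_le_self _ _ _).trans If)
              exact Set.indicator_apply_le' id fun _ => bot_le
          _ = C * g X := by
              rw [mul_left_comm, ← ENNReal.rpow_add_of_nonneg _ _ hη0 (by linarith),
                show η + (2 - θ - η - 1 + θ) = 1 by ring, ENNReal.rpow_one]
    _ = C * ∫⁻ X, g X ∂μ := lintegral_const_mul _ hg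
    _ ≤ C := mul_le_of_le_one_right' Ig

theorem exists_hardyLittlewoodSobolev [Nontrivial E] {θ η : ℝ} (hθ0 : 0 < θ) (hθ1 : θ < 1)
    (hη0 : 0 < η) (hη1 : η < 1) (hθη : 1 < θ + η) :
    ∃ C : ℝ≥0∞, C ≠ ⊤ ∧ ∀ f g : E → ℝ≥0∞, Measurable f → Measurable g →
      ∫⁻ Y, f Y ∂μ ≤ 1 → ∫⁻ X, g X ∂μ ≤ 1 →
      ∫⁻ X, ∫⁻ Y, ENNReal.ofReal (‖X - Y‖ ^ (-((Module.finrank ℝ E : ℝ) * (2 - θ - η)))) *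
        f Y ^ θ * g X ^ η ∂μ ∂μ ≤ C := by
  obtain ⟨C₁, hC₁, h₁⟩ := exists_lintegral_riesz_indicator_le μ hθ0 hθ1 hη0.le hη1 hθη
  obtain ⟨C₂, hC₂, h₂⟩ := exists_lintegral_riesz_indicator_le μ hη0 hη1 hθ0.le hθ1
    (by linarith : 1 < η + θ)
  refine ⟨C₁ + C₂, ENNReal.add_ne_top.2 ⟨hC₁, hC₂⟩, fun f g hf hg If Ig => ?_⟩
  set k : E → E → ℝ≥0∞ := fun X Y =>
    ENNReal.ofReal (‖X - Y‖ ^ (-((Module.finrank ℝ E : ℝ) * (2 - θ - η)))) with hk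
  have k_symm : ∀ X Y, ENNReal.ofReal
      (‖Y - X‖ ^ (-((Module.finrank ℝ E : ℝ) * (2 - η - θ)))) = k X Y := fun X Y => by
    simp only [hk, norm_sub_rev Y X, sub_right_comm]
  simp only [k_symm] at h₂
  have hkm : Measurable fun z : E × E => k z.1 z.2 := by fun_prop
  have hF : Measurable fun z : E × E => {Y | f Y ≤ g z.1}.indicator f z.2 :=
    (hf.comp measurable_snd).indicator
      (measurableSet_le (hf.comp measurable_snd) (hg.comp measurable_fst))
  have hG : Measurable fun z : E × E => {X | g X ≤ f z.2}.indicator g z.1 :=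
    (hg.comp measurable_fst).indicator
      (measurableSet_le (hg.comp measurable_fst) (hf.comp measurable_snd))
  have hsplit : ∀ X Y, k X Y * f Y ^ θ * g X ^ η ≤
      g X ^ η * (k X Y * {Y | f Y ≤ g X}.indicator f Y ^ θ) +
        f Y ^ θ * (k X Y * {X | g X ≤ f Y}.indicator g X ^ η) := fun X Y => by
    rcases le_total (f Y) (g X) with h | h
    · rw [Set.indicator_of_mem (by exact h)]
      exact le_add_right (le_of_eq (by ring))
    · rw [Set.indicator_of_mem (s := {X | g X ≤ f Y}) (by exact h)]
      exact le_add_left (le_of_eq (by ring))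
  calc ∫⁻ X, ∫⁻ Y, k X Y * f Y ^ θ * g X ^ η ∂μ ∂μ
      ≤ ∫⁻ X, ∫⁻ Y, (g X ^ η * (k X Y * {Y | f Y ≤ g X}.indicator f Y ^ θ) +
          f Y ^ θ * (k X Y * {X | g X ≤ f Y}.indicator g X ^ η)) ∂μ ∂μ :=
        lintegral_mono fun X => lintegral_mono fun Y => hsplit X Y
    _ = ∫⁻ X, ∫⁻ Y, g X ^ η * (k X Y * {Y | f Y ≤ g X}.indicator f Y ^ θ) ∂μ ∂μ +
        ∫⁻ Y, ∫⁻ X, f Y ^ θ * (k X Y * {X | g X ≤ f Y}.indicator g X ^ η) ∂μ ∂μ := by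
        rw [lintegral_lintegral_swap (f := fun Y X => f Y ^ θ * (k X Y *
            {X | g X ≤ f Y}.indicator g X ^ η))
            (((hf.comp measurable_snd).pow_const θ |>.mul
              (hkm.mul (hG.pow_const η))).comp measurable_swap).aemeasurable,
          ← lintegral_add_left]
        · congr with X
          rw [lintegral_add_left]
          exact measurable_const.mul ((hkm.comp measurable_prodMk_left).mul
            ((hF.comp measurable_prodMk_left).pow_const θ))
        · exact Measurable.lintegral_prod_right' (f := fun z : E × E => g z.1 ^ η *
            (k z.1 z.2 * {Y | f Y ≤ g z.1}.indicator f z.2 ^ θ)) (by fun_prop)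
    _ ≤ C₁ + C₂ := add_le_add (h₁ f g hf hg If Ig) (h₂ g f hg hf Ig If)

theorem exists_setLIntegral_hardyLittlewoodSobolev [Nontrivial E] {s : Set E}
    (hs : MeasurableSet s) {θ η : ℝ} (hθ0 : 0 < θ) (hθ1 : θ < 1) (hη0 : 0 < η) (hη1 : η < 1)
    (hθη : 1 < θ + η) :
    ∃ C : ℝ≥0∞, C ≠ ⊤ ∧ ∀ f g : E → ℝ≥0∞, Measurable f → Measurable g →
      ∫⁻ Y in s, f Y ∂μ ≤ 1 → ∫⁻ X in s, g X ∂μ ≤ 1 →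
      ∫⁻ X in s, ∫⁻ Y in s,
        ENNReal.ofReal (‖X - Y‖ ^ (-((Module.finrank ℝ E : ℝ) * (2 - θ - η)))) *
          f Y ^ θ * g X ^ η ∂μ ∂μ ≤ C := by
  obtain ⟨C, hC, h⟩ := exists_hardyLittlewoodSobolev μ hθ0 hθ1 hη0 hη1 hθη
  refine ⟨C, hC, fun f g hf hg If Ig => ?_⟩
  rw [← lintegral_indicator hs] at If Ig
  calc _ = ∫⁻ X in s, ∫⁻ Y in s,
          ENNReal.ofReal (‖X - Y‖ ^ (-((Module.finrank ℝ E : ℝ) * (2 - θ - η)))) *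
            s.indicator f Y ^ θ * s.indicator g X ^ η ∂μ ∂μ :=
        setLIntegral_congr_fun hs fun X hX => setLIntegral_congr_fun hs fun Y hY => by
          simp only [Set.indicator_of_mem hX, Set.indicator_of_mem hY]
    _ ≤ ∫⁻ X, ∫⁻ Y, ENNReal.ofReal (‖X - Y‖ ^ (-((Module.finrank ℝ E : ℝ) * (2 - θ - η)))) *
          s.indicator f Y ^ θ * s.indicator g X ^ η ∂μ ∂μ :=
        lintegral_mono' Measure.restrict_le_self fun X =>
          lintegral_mono' Measure.restrict_le_self le_rfl
    _ ≤ C := h _ _ (hf.indicator hs) (hg.indicator hs) If Ig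

end HardyLittlewoodSobolev

section Schur

variable {α β : Type*} [MeasurableSpace α] [MeasurableSpace β] {μ : Measure α} {ν : Measure β}

theorem lintegral_prod_mul_fst_le [SFinite ν] {B : α → β → ℝ≥0∞} {ψ : α → ℝ≥0∞}
    (hB : Measurable fun z : α × β => B z.1 z.2) (hψ : Measurable ψ) {C : ℝ≥0∞}
    (hBC : ∀ᵐ X ∂μ, ∫⁻ Y, B X Y ∂ν ≤ C) (iψ : ∫⁻ X, ψ X ∂μ ≤ 1) :
    ∫⁻ z, B z.1 z.2 * ψ z.1 ∂(μ.prod ν) ≤ C := by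
  rw [lintegral_prod _ (by fun_prop)]
  calc ∫⁻ X, ∫⁻ Y, B X Y * ψ X ∂ν ∂μ = ∫⁻ X, (∫⁻ Y, B X Y ∂ν) * ψ X ∂μ :=
        lintegral_congr fun X => lintegral_mul_const _ (hB.comp measurable_prodMk_left)
    _ ≤ ∫⁻ X, C * ψ X ∂μ := lintegral_mono_ae (hBC.mono fun X hX => mul_le_mul_left hX _)
    _ = C * ∫⁻ X, ψ X ∂μ := lintegral_const_mul _ hψ
    _ ≤ C := mul_le_of_le_one_right' iψ

theorem lintegral_prod_mul_snd_le [SFinite μ] [SFinite ν] {A : α → β → ℝ≥0∞} {φ : β → ℝ≥0∞}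
    (hA : Measurable fun z : α × β => A z.1 z.2) (hφ : Measurable φ) {C : ℝ≥0∞}
    (hAC : ∀ᵐ Y ∂ν, ∫⁻ X, A X Y ∂μ ≤ C) (iφ : ∫⁻ Y, φ Y ∂ν ≤ 1) :
    ∫⁻ z, A z.1 z.2 * φ z.2 ∂(μ.prod ν) ≤ C := by
  rw [← lintegral_prod_swap]
  exact lintegral_prod_mul_fst_le (B := fun Y X => A X Y) (hA.comp measurable_swap) hφ hAC iφ

/- Hölder's inequality for the three factors `A X Y * φ Y`, `B X Y * ψ X` and `φ Y * ψ X`, with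
exponents `y`, `1 - x` and `x - y`. -/
theorem lintegral_bilinear_le_of_schur [SFinite μ] [SFinite ν] {x y : ℝ} (hx : x ≤ 1) (hy : 0 ≤ y)
    (hyx : y ≤ x) {A B : α → β → ℝ≥0∞} (hA : Measurable fun z : α × β => A z.1 z.2)
    (hB : Measurable fun z : α × β => B z.1 z.2) {C₁ C₂ : ℝ≥0∞}
    (hAC : ∀ᵐ Y ∂ν, ∫⁻ X, A X Y ∂μ ≤ C₁) (hBC : ∀ᵐ X ∂μ, ∫⁻ Y, B X Y ∂ν ≤ C₂)
    {φ : β → ℝ≥0∞} {ψ : α → ℝ≥0∞} (hφ : Measurable φ) (hψ : Measurable ψ)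
    (iφ : ∫⁻ Y, φ Y ∂ν ≤ 1) (iψ : ∫⁻ X, ψ X ∂μ ≤ 1) :
    ∫⁻ X, ∫⁻ Y, A X Y ^ y * B X Y ^ (1 - x) * φ Y ^ x * ψ X ^ (1 - y) ∂ν ∂μ ≤
      C₁ ^ y * C₂ ^ (1 - x) := by
  have hx' : 0 ≤ 1 - x := by linarith
  have hyx' : 0 ≤ x - y := by linarith
  have hfactor : ∀ X Y, A X Y ^ y * B X Y ^ (1 - x) * φ Y ^ x * ψ X ^ (1 - y) =
      (A X Y * φ Y) ^ y * (B X Y * ψ X) ^ (1 - x) * (φ Y * ψ X) ^ (x - y) := fun X Y => by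
    have hφx : φ Y ^ x = φ Y ^ y * φ Y ^ (x - y) := by
      rw [← ENNReal.rpow_add_of_nonneg _ _ hy hyx']; congr 1; ring
    have hψy : ψ X ^ (1 - y) = ψ X ^ (1 - x) * ψ X ^ (x - y) := by
      rw [← ENNReal.rpow_add_of_nonneg _ _ hx' hyx']; congr 1; ring
    rw [ENNReal.mul_rpow_of_nonneg _ _ hy, ENNReal.mul_rpow_of_nonneg _ _ hx',
      ENNReal.mul_rpow_of_nonneg _ _ hyx', hφx, hψy]
    ring
  have iφψ : ∫⁻ z, φ z.2 * ψ z.1 ∂(μ.prod ν) ≤ 1 :=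
    lintegral_prod_mul_fst_le (B := fun _ => φ) (by fun_prop) hψ (.of_forall fun _ => iφ) iψ
  have hHolder := ENNReal.lintegral_prod_norm_pow_le (μ := μ.prod ν) Finset.univ
    (f := ![fun z => A z.1 z.2 * φ z.2, fun z => B z.1 z.2 * ψ z.1, fun z => φ z.2 * ψ z.1])
    (p := ![y, 1 - x, x - y])
    (by intro i _; fin_cases i <;> dsimp <;> fun_prop)
    (by simp only [Fin.sum_univ_three, Matrix.cons_val]; ring) (by intro i _; fin_cases i <;> simpa)
  simp only [Fin.prod_univ_three, Matrix.cons_val] at hHolder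
  calc ∫⁻ X, ∫⁻ Y, A X Y ^ y * B X Y ^ (1 - x) * φ Y ^ x * ψ X ^ (1 - y) ∂ν ∂μ
      = ∫⁻ z, (A z.1 z.2 * φ z.2) ^ y * (B z.1 z.2 * ψ z.1) ^ (1 - x) *
          (φ z.2 * ψ z.1) ^ (x - y) ∂(μ.prod ν) := by
        simp_rw [hfactor]
        rw [lintegral_prod _ (by fun_prop)]
    _ ≤ _ := hHolder
    _ ≤ C₁ ^ y * C₂ ^ (1 - x) * 1 ^ (x - y) := by
        gcongr
        · exact lintegral_prod_mul_snd_le hA hφ hAC iφ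
        · exact lintegral_prod_mul_fst_le hB hψ hBC iψ
    _ = C₁ ^ y * C₂ ^ (1 - x) := by rw [ENNReal.one_rpow, mul_one]

theorem rpow_lintegral_rpow_le_of_forall_lintegral_mul_le [SigmaFinite μ] {y : ℝ} (hy0 : 0 < y)
    (hy1 : y < 1) {T : α → ℝ≥0∞} {C : ℝ≥0∞}
    (H : ∀ ψ : α → ℝ≥0∞, Measurable ψ → ∫⁻ X, ψ X ∂μ ≤ 1 →
      ∫⁻ X, T X * ψ X ^ (1 - y) ∂μ ≤ C) :
    (∫⁻ X, T X ^ y⁻¹ ∂μ) ^ y ≤ C := by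
  by_contra! hlt
  rw [← ENNReal.rpow_inv_lt_iff hy0, lintegral_eq_nnreal] at hlt
  simp only [lt_iSup_iff] at hlt
  obtain ⟨g₀, hg₀, hlt⟩ := hlt
  rw [← SimpleFunc.lintegral_eq_lintegral] at hlt
  obtain ⟨g, hg, hfin, hlt⟩ := SimpleFunc.exists_lt_lintegral_simpleFunc_of_lt_lintegral hlt
  set I := ∫⁻ X, (g X : ℝ≥0∞) ∂μ
  have hI0 : I ≠ 0 := (bot_le.trans_lt hlt).ne'
  have hgm : Measurable fun X => (g X : ℝ≥0∞) := g.measurable.coe_nnreal_ennreal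
  have hgT : ∀ X, (g X : ℝ≥0∞) ≤ T X * (g X : ℝ≥0∞) ^ (1 - y) := fun X => by
    calc (g X : ℝ≥0∞) = (g X : ℝ≥0∞) ^ y * (g X : ℝ≥0∞) ^ (1 - y) := by
          rw [← ENNReal.rpow_add_of_nonneg _ _ hy0.le (by linarith), add_sub_cancel,
            ENNReal.rpow_one]
      _ ≤ T X * (g X : ℝ≥0∞) ^ (1 - y) := by
          gcongr
          rw [← ENNReal.le_rpow_inv_iff hy0]
          exact (ENNReal.coe_le_coe.2 (hg X)).trans (hg₀ X)
  refine (ENNReal.rpow_inv_lt_iff hy0).1 hlt |>.not_ge ?_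
  calc I ^ y = I⁻¹ ^ (1 - y) * I := by
        rw [ENNReal.inv_rpow, ← ENNReal.rpow_neg]
        nth_rw 3 [← ENNReal.rpow_one I]
        rw [← ENNReal.rpow_add _ _ hI0 hfin.ne, neg_sub, sub_add_cancel]
    _ = ∫⁻ X, I⁻¹ ^ (1 - y) * g X ∂μ := (lintegral_const_mul _ hgm).symm
    _ ≤ ∫⁻ X, T X * (I⁻¹ * g X) ^ (1 - y) ∂μ := by
        refine lintegral_mono fun X => ?_
        rw [ENNReal.mul_rpow_of_nonneg _ _ (by linarith), mul_left_comm]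
        gcongr
        exact hgT X
    _ ≤ C := H _ (by fun_prop) (by
        rw [lintegral_const_mul _ hgm, ENNReal.inv_mul_cancel hI0 hfin.ne])

theorem lintegral_operator_le_of_normalized {x y : ℝ} (hx : 0 < x) (hy : 0 < y)
    {k : α → β → ℝ≥0∞} {C : ℝ≥0∞} (hC : C ≠ 0)
    (H : ∀ φ : β → ℝ≥0∞, Measurable φ → ∫⁻ Y, φ Y ∂ν ≤ 1 →
      (∫⁻ X, (∫⁻ Y, k X Y * φ Y ^ x ∂ν) ^ y⁻¹ ∂μ) ^ y ≤ C)
    {φ : β → ℝ≥0∞} (hφ : Measurable φ) :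
    (∫⁻ X, (∫⁻ Y, k X Y * φ Y ^ x ∂ν) ^ y⁻¹ ∂μ) ^ y ≤ C * (∫⁻ Y, φ Y ∂ν) ^ x := by
  set I := ∫⁻ Y, φ Y ∂ν
  rcases eq_or_ne I 0 with h0 | h0
  · have hzero : ∀ X, ∫⁻ Y, k X Y * φ Y ^ x ∂ν = 0 := fun X => by
      refine (lintegral_congr_ae ?_).trans lintegral_zero
      filter_upwards [(lintegral_eq_zero_iff hφ).1 h0] with Y hY
      simp [hY, hx]
    simp [hzero, hy]
  rcases eq_or_ne I ⊤ with ht | ht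
  · rw [ht, ENNReal.top_rpow_of_pos hx, ENNReal.mul_top hC]; exact le_top
  have hscale : ∀ X, ∫⁻ Y, k X Y * (I⁻¹ * φ Y) ^ x ∂ν =
      I⁻¹ ^ x * ∫⁻ Y, k X Y * φ Y ^ x ∂ν := fun X => by
    rw [← lintegral_const_mul' _ _ (by simp [ENNReal.rpow_eq_top_iff, h0, ht])]
    refine lintegral_congr fun Y => ?_
    rw [ENNReal.mul_rpow_of_nonneg _ _ hx.le, mul_left_comm]
  have hnorm := H (fun Y => I⁻¹ * φ Y) (by fun_prop) (by
    rw [lintegral_const_mul _ hφ, ENNReal.inv_mul_cancel h0 ht])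
  simp_rw [hscale, ENNReal.mul_rpow_of_nonneg _ _ (inv_nonneg.2 hy.le)] at hnorm
  rw [lintegral_const_mul' _ _ (by simp [ENNReal.rpow_eq_top_iff, h0, ht]),
    ENNReal.mul_rpow_of_nonneg _ _ hy.le, ENNReal.rpow_inv_rpow hy.ne', ENNReal.inv_rpow,
    ENNReal.inv_mul_le_iff (by simp [h0, ht, hx]) (by simp [ENNReal.rpow_eq_top_iff, h0, ht])]
    at hnorm
  rwa [mul_comm C]

theorem lintegral_operator_le_of_bilinear [SigmaFinite μ] [SFinite ν] {x y : ℝ} (hx : 0 < x)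
    (hy0 : 0 < y) (hy1 : y < 1) {k : α → β → ℝ≥0∞} (hk : Measurable fun z : α × β => k z.1 z.2)
    {C : ℝ≥0∞} (hC : C ≠ 0)
    (H : ∀ (φ : β → ℝ≥0∞) (ψ : α → ℝ≥0∞), Measurable φ → Measurable ψ → ∫⁻ Y, φ Y ∂ν ≤ 1 →
      ∫⁻ X, ψ X ∂μ ≤ 1 → ∫⁻ X, ∫⁻ Y, k X Y * φ Y ^ x * ψ X ^ (1 - y) ∂ν ∂μ ≤ C)
    {φ : β → ℝ≥0∞} (hφ : Measurable φ) :
    (∫⁻ X, (∫⁻ Y, k X Y * φ Y ^ x ∂ν) ^ y⁻¹ ∂μ) ^ y ≤ C * (∫⁻ Y, φ Y ∂ν) ^ x := by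
  refine lintegral_operator_le_of_normalized hx hy0 hC (fun φ hφ iφ => ?_) hφ
  refine rpow_lintegral_rpow_le_of_forall_lintegral_mul_le hy0 hy1 fun ψ hψ iψ => ?_
  refine (lintegral_congr fun X => ?_).trans_le (H φ ψ hφ hψ iφ iψ)
  exact (lintegral_mul_const _ ((hk.comp measurable_prodMk_left).mul (hφ.pow_const x))).symm

end Schur

section HalfSpace

variable {n : ℕ}

@[fun_prop]
theorem continuous_height : Continuous (height : HalfAmbient n → ℝ) := by
  unfold height; fun_prop

@[fun_prop]
theorem measurable_height : Measurable (height : HalfAmbient n → ℝ) :=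
  continuous_height.measurable

theorem isOpen_halfSpace : IsOpen (halfSpace n) :=
  isOpen_lt continuous_const continuous_height

theorem measurableSet_halfSpace : MeasurableSet (halfSpace n) :=
  isOpen_halfSpace.measurableSet

@[simp] theorem height_add (X Y : HalfAmbient n) : height (X + Y) = height X + height Y := rfl

@[simp] theorem height_sub (X Y : HalfAmbient n) : height (X - Y) = height X - height Y := rfl

@[simp] theorem height_smul (c : ℝ) (X : HalfAmbient n) : height (c • X) = c * height X := rfl

@[simp] theorem height_eLast : height (eLast n) = 1 := by simp [height, eLast]

@[simp] theorem norm_eLast : ‖eLast n‖ = 1 := by simp [eLast]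

theorem abs_height_le (X : HalfAmbient n) : |height X| ≤ ‖X‖ := by
  simpa [height] using PiLp.norm_apply_le X (Fin.last n)

theorem finrank_halfAmbient : (Module.finrank ℝ (HalfAmbient n) : ℝ) = n + 1 := by
  simp [HalfAmbient]

/-- The orthogonal projection to the boundary `{t = 0}`. -/
noncomputable def bdryProj (X : HalfAmbient n) : HalfAmbient n := X - height X • eLast n

@[simp] theorem height_bdryProj (X : HalfAmbient n) : height (bdryProj X) = 0 := by
  simp [bdryProj]

@[fun_prop]
theorem continuous_bdryProj : Continuous (bdryProj : HalfAmbient n → HalfAmbient n) := by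
  unfold bdryProj; fun_prop

theorem norm_sub_bdryProj (X : HalfAmbient n) : ‖X - bdryProj X‖ = |height X| := by
  simp [bdryProj, norm_smul]

theorem lintegral_rpow_mul_one_add_rpow_ne_top {a d : ℝ} (ha : -1 < a) (hd : a + 1 < d) :
    ∫⁻ t in Set.Ioi (0 : ℝ), ENNReal.ofReal (t ^ a * (1 + t) ^ (-d)) ≠ ⊤ := by
  rw [← Set.Ioc_union_Ioi_eq_Ioi zero_le_one]
  refine ne_top_of_le_ne_top (ENNReal.add_ne_top.2 ⟨?_, ?_⟩) (lintegral_union_le _ _ _)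
  · have hint : IntegrableOn (fun t : ℝ => t ^ a) (Set.Ioc 0 1) := by
      rw [← intervalIntegrable_iff_integrableOn_Ioc_of_le zero_le_one]
      exact intervalIntegral.intervalIntegrable_rpow' ha
    refine ne_top_of_le_ne_top hint.setLIntegral_lt_top.ne ?_
    refine setLIntegral_mono' measurableSet_Ioc fun t ht => ENNReal.ofReal_le_ofReal ?_
    have ht0 : 0 < t := ht.1
    refine mul_le_of_le_one_right (by positivity) ?_
    exact Real.rpow_le_one_of_one_le_of_nonpos (by linarith) (by linarith)
  · have hint : IntegrableOn (fun t : ℝ => t ^ (a - d)) (Set.Ioi 1) :=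
      integrableOn_Ioi_rpow_of_lt (by linarith) one_pos
    refine ne_top_of_le_ne_top hint.setLIntegral_lt_top.ne ?_
    refine setLIntegral_mono' measurableSet_Ioi fun t ht => ENNReal.ofReal_le_ofReal ?_
    have ht0 : 0 < t := lt_trans one_pos ht
    rw [sub_eq_add_neg, Real.rpow_add ht0]
    gcongr ?_ * ?_
    exact Real.rpow_le_rpow_of_nonpos ht0 (by linarith) (by linarith)

/-- The coordinates `(t, x)` of a point of the half space, as a measurable equivalence. The factor
`ℝⁿ` carries the sup norm. -/
noncomputable def splitCoord (n : ℕ) : HalfAmbient n ≃ᵐ ℝ × (Fin n → ℝ) :=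
  (MeasurableEquiv.toLp 2 (Fin (n + 1) → ℝ)).symm.trans
    (MeasurableEquiv.piFinSuccAbove (fun _ => ℝ) (Fin.last n))

theorem measurePreserving_splitCoord : MeasurePreserving (splitCoord n) :=
  (volume_preserving_piFinSuccAbove (fun _ => ℝ) (Fin.last n)).comp
    (EuclideanSpace.volume_preserving_symm_measurableEquiv_toLp (Fin (n + 1)))

theorem splitCoord_fst (X : HalfAmbient n) : (splitCoord n X).1 = height X := rfl

theorem norm_splitCoord_snd_le (X : HalfAmbient n) : ‖(splitCoord n X).2‖ ≤ ‖X‖ :=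
  (pi_norm_le_iff_of_nonneg (norm_nonneg _)).2 fun i =>
    PiLp.norm_apply_le X ((Fin.last n).succAbove i)

theorem setLIntegral_halfSpace_mul_splitCoord_snd {f : ℝ → ℝ≥0∞} {g : (Fin n → ℝ) → ℝ≥0∞}
    (hf : Measurable f) (hg : Measurable g) :
    ∫⁻ X in halfSpace n, f (height X) * g (splitCoord n X).2 =
      (∫⁻ t in Set.Ioi 0, f t) * ∫⁻ x, g x := by
  have hpre : halfSpace n = splitCoord n ⁻¹' (Set.Ioi 0 ×ˢ Set.univ) := by
    ext X; simp [halfSpace, splitCoord_fst]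
  rw [hpre, ← lintegral_prod_mul (by fun_prop) (by fun_prop),
    ← Measure.restrict_univ (μ := (volume : Measure (Fin n → ℝ))), Measure.prod_restrict,
    ← Measure.volume_eq_prod]
  exact measurePreserving_splitCoord.setLIntegral_comp_preimage_emb
    (splitCoord n).measurableEmbedding (fun z => f z.1 * g z.2) _

theorem lintegral_halfSpace_rpow_ne_top {a d : ℝ} (ha : -1 < a) (hd : n + 1 + a < d) :
    ∫⁻ X in halfSpace n, ENNReal.ofReal (height X ^ a * (1 + ‖X‖) ^ (-d)) ≠ ⊤ := by
  obtain ⟨d₁, d₂, hd₁, hd₂, _, _, rfl⟩ :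
      ∃ d₁ d₂ : ℝ, n < d₁ ∧ a + 1 < d₂ ∧ 0 < d₁ ∧ 0 < d₂ ∧ d = d₂ + d₁ := by
    have := n.cast_nonneg (α := ℝ)
    exact ⟨n + (d - (n + 1 + a)) / 2, a + 1 + (d - (n + 1 + a)) / 2, by linarith, by linarith,
      by linarith, by linarith, by ring⟩
  have hfin := ENNReal.mul_ne_top (lintegral_rpow_mul_one_add_rpow_ne_top ha hd₂)
    (finite_integral_one_add_norm (E := Fin n → ℝ) (μ := volume) (by simpa using hd₁)).ne
  rw [← setLIntegral_halfSpace_mul_splitCoord_snd (by fun_prop) (by fun_prop)] at hfin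
  refine ne_top_of_le_ne_top hfin
    (setLIntegral_mono' measurableSet_halfSpace fun X (hX : 0 < height X) => ?_)
  rw [← ENNReal.ofReal_mul (by positivity), neg_add, Real.rpow_add (by positivity), ← mul_assoc]
  refine ENNReal.ofReal_le_ofReal ?_
  gcongr ?_ * ?_ * ?_
  · exact Real.rpow_le_rpow_of_nonpos (by positivity)
      (by linarith [le_abs_self (height X), abs_height_le X]) (by linarith)
  · exact Real.rpow_le_rpow_of_nonpos (by positivity)
      (by linarith [norm_splitCoord_snd_le X]) (by linarith)

theorem exists_lintegral_halfSpace_rpow_le {a d : ℝ} (ha : -1 < a) (hd : n + 1 + a < d) :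
    ∃ C : ℝ≥0∞, C ≠ ⊤ ∧ ∀ (s : ℝ) (Z : HalfAmbient n), 0 < s → height Z = 0 →
      ∫⁻ X in halfSpace n, ENNReal.ofReal (height X ^ a * (s + ‖X - Z‖) ^ (-d)) ≤
        C * ENNReal.ofReal (s ^ (a + (n + 1) - d)) := by
  refine ⟨_, lintegral_halfSpace_rpow_ne_top ha hd, fun s Z hs hZ => le_of_eq ?_⟩
  rw [← lintegral_indicator measurableSet_halfSpace, ← lintegral_indicator measurableSet_halfSpace,
    ← lintegral_add_right_eq_self _ Z, lintegral_eq_lintegral_comp_smul volume hs,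
    finrank_halfAmbient, ← lintegral_const_mul' _ _ ENNReal.ofReal_ne_top,
    ← lintegral_mul_const' _ _ ENNReal.ofReal_ne_top]
  refine lintegral_congr fun X => ?_
  by_cases hX : 0 < height X
  · have hheight : height (s • X + Z) = s * height X := by simp [hZ]
    have hnorm : s + ‖s • X + Z - Z‖ = s * (1 + ‖X‖) := by
      rw [add_sub_cancel_right, norm_smul, Real.norm_of_nonneg hs.le]; ring
    have hpow : s ^ (a + (n + 1) - d) = s ^ ((n : ℝ) + 1) * s ^ a * s ^ (-d) := by
      rw [← Real.rpow_add hs, ← Real.rpow_add hs]; congr 1; ring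
    rw [Set.indicator_of_mem (by simp [halfSpace, hX, hs, hZ]), Set.indicator_of_mem (by exact hX),
      ← ENNReal.ofReal_mul (by positivity), ← ENNReal.ofReal_mul (by positivity), hheight, hnorm,
      Real.mul_rpow hs.le hX.le, Real.mul_rpow hs.le (by positivity), hpow]
    congr 1
    ring
  · rw [Set.indicator_of_notMem (by simpa [halfSpace, hs, hZ] using hX),
      Set.indicator_of_notMem (by exact hX), mul_zero, zero_mul]

end HalfSpace

section WeightedRiesz

variable {n : ℕ}

theorem rpow_le_two_rpow_abs {z e : ℝ} (h1 : 1 / 2 ≤ z) (h2 : z ≤ 2) : z ^ e ≤ 2 ^ |e| := by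
  have hz : 0 < z := by linarith
  rcases le_total 0 e with he | he
  · rw [abs_of_nonneg he]
    exact Real.rpow_le_rpow hz.le h2 he
  · rw [abs_of_nonpos he, Real.rpow_neg (by norm_num), ← Real.inv_rpow (by norm_num)]
    exact Real.rpow_le_rpow_of_nonpos (by norm_num) (by linarith) he

theorem rpow_mul_rpow_mul_rpow_le_of_near {t s ρ a b e : ℝ} (ht : 0 < t) (hs : 0 < s) (hρ : 0 ≤ ρ)
    (hts : |t - s| ≤ ρ) (hρt : 2 * ρ < t) (hab : b ≤ a) (he : e ≠ 0) :
    t ^ b * s ^ (-a) * ρ ^ e ≤ 2 ^ |a| * ρ ^ (e + (b - a)) := by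
  rcases hρ.eq_or_lt with rfl | hρ0
  · rw [Real.zero_rpow he, mul_zero]; positivity
  have hst := abs_le.1 hts
  have hratio : (s / t) ^ (-a) ≤ 2 ^ |a| := by
    rw [← abs_neg a]
    refine rpow_le_two_rpow_abs ?_ ?_
    · rw [le_div_iff₀ ht]; linarith
    · rw [div_le_iff₀ ht]; linarith
  calc t ^ b * s ^ (-a) * ρ ^ e = (s / t) ^ (-a) * t ^ (b - a) * ρ ^ e := by
        rw [Real.div_rpow hs.le ht.le, sub_eq_add_neg, Real.rpow_add ht]
        field_simp
    _ ≤ 2 ^ |a| * ρ ^ (b - a) * ρ ^ e := by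
        gcongr ?_ * ?_ * _
        exact Real.rpow_le_rpow_of_nonpos hρ0 (by linarith) (by linarith)
    _ = 2 ^ |a| * ρ ^ (e + (b - a)) := by rw [mul_assoc, ← Real.rpow_add hρ0, add_comm e]

theorem rpow_neg_le_mul_rpow_neg {c v ρ d : ℝ} (hc : 0 < c) (hρ : 0 < ρ) (hv : 0 < v)
    (hvρ : v ≤ c * ρ) (hd : 0 ≤ d) : ρ ^ (-d) ≤ c ^ d * v ^ (-d) :=
  calc ρ ^ (-d) = c ^ d * (c * ρ) ^ (-d) := by
        rw [Real.mul_rpow hc.le hρ.le, ← mul_assoc, ← Real.rpow_add hc, add_neg_cancel,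
          Real.rpow_zero, one_mul]
    _ ≤ c ^ d * v ^ (-d) := by
        gcongr c ^ d * ?_
        exact Real.rpow_le_rpow_of_nonpos hv hvρ (by linarith)

/-- The weighted Riesz kernel `t ^ b * s ^ (-a) * |X - Y| ^ (-l)`, where `t` and `s` are the heights
of `X` and `Y`; it is meaningful for `X` and `Y` in the half space only. -/
noncomputable def weightedKernel (a b l : ℝ) (X Y : HalfAmbient n) : ℝ≥0∞ :=
  ENNReal.ofReal (height X ^ b * height Y ^ (-a) * ‖X - Y‖ ^ (-l))

@[fun_prop]
theorem measurable_weightedKernel (a b l : ℝ) {β : Type*} [MeasurableSpace β]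
    {f g : β → HalfAmbient n} (hf : Measurable f) (hg : Measurable g) :
    Measurable fun z => weightedKernel a b l (f z) (g z) := by
  unfold weightedKernel; fun_prop

/-- The majorant used in the Schur test for the part of the weighted Riesz kernel away from the
diagonal. The powers are chosen so that its integral in `X` does not depend on `Y`. -/
noncomputable def schurMajorant (α d : ℝ) (X Y : HalfAmbient n) : ℝ≥0∞ :=
  ENNReal.ofReal (height X ^ α * height Y ^ (-(α + (n + 1) - d)) *
    (7 ^ d * (height Y + ‖X - bdryProj Y‖) ^ (-d)))

@[fun_prop]
theorem measurable_schurMajorant (α d : ℝ) {β : Type*} [MeasurableSpace β]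
    {f g : β → HalfAmbient n} (hf : Measurable f) (hg : Measurable g) :
    Measurable fun z => schurMajorant α d (f z) (g z) := by
  unfold schurMajorant; fun_prop

theorem exists_lintegral_schurMajorant_le {α d : ℝ} (hα : -1 < α) (hd : n + 1 + α < d) :
    ∃ C : ℝ≥0∞, C ≠ ⊤ ∧ ∀ Y ∈ halfSpace n, ∫⁻ X in halfSpace n, schurMajorant α d X Y ≤ C := by
  obtain ⟨C, hC, h⟩ := exists_lintegral_halfSpace_rpow_le hα hd
  refine ⟨ENNReal.ofReal (7 ^ d) * C, ENNReal.mul_ne_top ENNReal.ofReal_ne_top hC,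
    fun Y (hY : 0 < height Y) => ?_⟩
  calc ∫⁻ X in halfSpace n, schurMajorant α d X Y
      = ENNReal.ofReal (7 ^ d * height Y ^ (-(α + (n + 1) - d))) * ∫⁻ X in halfSpace n,
          ENNReal.ofReal (height X ^ α * (height Y + ‖X - bdryProj Y‖) ^ (-d)) := by
        rw [← lintegral_const_mul' _ _ ENNReal.ofReal_ne_top]
        refine lintegral_congr fun X => ?_
        rw [schurMajorant, ← ENNReal.ofReal_mul (by positivity)]
        congr 1; ring
    _ ≤ ENNReal.ofReal (7 ^ d * height Y ^ (-(α + (n + 1) - d))) *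
          (C * ENNReal.ofReal (height Y ^ (α + (n + 1) - d))) := by
        gcongr
        exact h (height Y) (bdryProj Y) hY (height_bdryProj Y)
    _ = ENNReal.ofReal (7 ^ d) * C := by
        rw [ENNReal.ofReal_mul (by positivity), mul_assoc, mul_left_comm _ C,
          ofReal_rpow_mul_ofReal_rpow hY, neg_add_cancel, Real.rpow_zero, ENNReal.ofReal_one,
          mul_one]

/-- Parameters for which the weighted Riesz kernel splits, away from the diagonal, as
`A ^ y * B ^ (1 - x)` with Schur majorants `A` and `B` to which `exists_lintegral_schurMajorant_le`
applies. -/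
structure SchurExponents (n : ℕ) (x y a b l α₁ α₂ d : ℝ) : Prop where
  neg_one_lt_fst : -1 < α₁
  fst_lt : n + 1 + α₁ < d
  neg_one_lt_snd : -1 < α₂
  snd_lt : n + 1 + α₂ < d
  nonneg : 0 ≤ d
  mul_eq : d * (1 - x + y) = l
  height_fst : α₁ * y + -(α₂ + (n + 1) - d) * (1 - x) = b
  height_snd : -(α₁ + (n + 1) - d) * y + α₂ * (1 - x) = -a

/- With `κ = 1 - x + y`, the two height equations have the one-parameter family of solutions
`α₁ = (b - h / y) / κ`, `α₂ = (-a - h / (1 - x)) / κ`; the four inequalities confine `h` to an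
interval. -/
theorem exists_schurExponents {x y a b l : ℝ} (hy : 0 < y) (hx : x < 1) (hb : -y < b)
    (ha : a < 1 - x) (hl0 : 0 < l) (hl : l = (n + 1) * (1 - x + y) + b - a) :
    ∃ α₁ α₂ d, SchurExponents n x y a b l α₁ α₂ d := by
  have hx' : 0 < 1 - x := by linarith
  obtain ⟨κ, hκ⟩ : ∃ κ, κ = 1 - x + y := ⟨_, rfl⟩
  have hκ0 : 0 < κ := by linarith
  obtain ⟨h, hlower, hupper⟩ : ∃ h, max (a * y) (-b * (1 - x)) < h ∧
      h < min ((κ + b) * y) ((κ - a) * (1 - x)) := by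
    refine exists_between (max_lt (lt_min ?_ ?_) (lt_min ?_ ?_)) <;> nlinarith
  obtain ⟨h₁, h₂⟩ := max_lt_iff.1 hlower
  obtain ⟨h₃, h₄⟩ := lt_min_iff.1 hupper
  rw [← lt_div_iff₀ hy] at h₁
  rw [← lt_div_iff₀ hx'] at h₂
  rw [← div_lt_iff₀ hy] at h₃
  rw [← div_lt_iff₀ hx'] at h₄
  rw [← hκ] at hl
  refine ⟨(b - h / y) / κ, (-a - h / (1 - x)) / κ, l / κ, ?_, ?_, ?_, ?_, by positivity, ?_, ?_, ?_⟩
  · rw [lt_div_iff₀ hκ0]; linarith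
  · rw [lt_div_iff₀ hκ0, add_mul, div_mul_cancel₀ _ hκ0.ne']; linarith
  · rw [lt_div_iff₀ hκ0]; linarith
  · rw [lt_div_iff₀ hκ0, add_mul, div_mul_cancel₀ _ hκ0.ne']; linarith
  · rw [← hκ, div_mul_cancel₀ _ hκ0.ne']
  · rw [hl]; field_simp; rw [hκ]; ring
  · rw [hl]; field_simp; rw [hκ]; ring

theorem weightedKernel_le_of_near {a b l : ℝ} (hab : b ≤ a) (hl : 0 < l) {X Y : HalfAmbient n}
    (hX : X ∈ halfSpace n) (hY : Y ∈ halfSpace n) (hXY : 2 * ‖X - Y‖ < height X) :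
    weightedKernel a b l X Y ≤
      ENNReal.ofReal (2 ^ |a|) * ENNReal.ofReal (‖X - Y‖ ^ (-l + (b - a))) := by
  rw [← ENNReal.ofReal_mul (by positivity)]
  exact ENNReal.ofReal_le_ofReal (rpow_mul_rpow_mul_rpow_le_of_near hX hY (norm_nonneg _)
    (abs_height_le (X - Y)) hXY hab (neg_lt_zero.2 hl).ne)

theorem height_add_norm_sub_bdryProj_le {X Y : HalfAmbient n} (hY : Y ∈ halfSpace n)
    (hXY : height X ≤ 2 * ‖X - Y‖) : height Y + ‖X - bdryProj Y‖ ≤ 7 * ‖X - Y‖ := by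
  have htri := norm_sub_le_norm_sub_add_norm_sub X Y (bdryProj Y)
  rw [norm_sub_bdryProj, abs_of_pos hY] at htri
  have hheight := abs_le.1 (abs_height_le (X - Y))
  rw [height_sub] at hheight
  linarith

theorem weightedKernel_le_of_far {x y a b l α₁ α₂ d : ℝ} (hy : 0 ≤ y) (hx : x ≤ 1)
    (hd : SchurExponents n x y a b l α₁ α₂ d) {X Y : HalfAmbient n} (hX : X ∈ halfSpace n)
    (hY : Y ∈ halfSpace n) (hXY : height X ≤ 2 * ‖X - Y‖) :
    weightedKernel a b l X Y ≤ schurMajorant α₁ d X Y ^ y * schurMajorant α₂ d Y X ^ (1 - x) := by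
  have hX0 : 0 < height X := hX
  have hY0 : 0 < height Y := hY
  have hx' : 0 ≤ 1 - x := by linarith
  set ρ := ‖X - Y‖
  have hρ0 : 0 < ρ := by linarith
  have hvρ := height_add_norm_sub_bdryProj_le hY hXY
  have hwρ : height X + ‖Y - bdryProj X‖ ≤ 7 * ρ := by
    have htri := norm_sub_le_norm_sub_add_norm_sub Y X (bdryProj X)
    rw [norm_sub_bdryProj, abs_of_pos hX, norm_sub_rev Y X] at htri
    linarith
  rw [schurMajorant, schurMajorant, weightedKernel,
    ENNReal.ofReal_rpow_of_nonneg (by positivity) hy,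
    ENNReal.ofReal_rpow_of_nonneg (by positivity) hx', ← ENNReal.ofReal_mul (by positivity)]
  refine ENNReal.ofReal_le_ofReal ?_
  calc height X ^ b * height Y ^ (-a) * ρ ^ (-l)
      = (height X ^ α₁ * height Y ^ (-(α₁ + (n + 1) - d)) * ρ ^ (-d)) ^ y *
          (height Y ^ α₂ * height X ^ (-(α₂ + (n + 1) - d)) * ρ ^ (-d)) ^ (1 - x) := by
        simp (disch := positivity) only [Real.mul_rpow, ← Real.rpow_mul]
        rw [← hd.height_fst, ← hd.height_snd, ← hd.mul_eq, Real.rpow_add hX, Real.rpow_add hY,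
          show -(d * (1 - x + y)) = -d * y + -d * (1 - x) by ring, Real.rpow_add hρ0]
        ring
    _ ≤ _ := by
        have hv := rpow_neg_le_mul_rpow_neg (by norm_num) hρ0 (by positivity) hvρ hd.nonneg
        have hw := rpow_neg_le_mul_rpow_neg (by norm_num) hρ0 (by positivity) hwρ hd.nonneg
        gcongr

theorem setLIntegral_mul_mul_le_of_le_add {K k S : HalfAmbient n → HalfAmbient n → ℝ≥0∞} {c : ℝ≥0∞}
    (hc : c ≠ ⊤) (hK : ∀ X ∈ halfSpace n, ∀ Y ∈ halfSpace n, K X Y ≤ c * k X Y + S X Y)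
    (hk : Measurable fun z : HalfAmbient n × HalfAmbient n => k z.1 z.2)
    {f g : HalfAmbient n → ℝ≥0∞} (hf : Measurable f) (hg : Measurable g) :
    ∫⁻ X in halfSpace n, ∫⁻ Y in halfSpace n, K X Y * f Y * g X ≤
      c * (∫⁻ X in halfSpace n, ∫⁻ Y in halfSpace n, k X Y * f Y * g X) +
        ∫⁻ X in halfSpace n, ∫⁻ Y in halfSpace n, S X Y * f Y * g X := by
  have hkX : ∀ X, Measurable (k X) := fun X => hk.comp measurable_prodMk_left
  calc _ ≤ ∫⁻ X in halfSpace n, ∫⁻ Y in halfSpace n,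
          (c * (k X Y * f Y * g X) + S X Y * f Y * g X) := by
        refine setLIntegral_mono' measurableSet_halfSpace fun X hX =>
          setLIntegral_mono' measurableSet_halfSpace fun Y hY => ?_
        rw [← mul_assoc, ← mul_assoc, ← add_mul, ← add_mul]
        gcongr
        exact hK X hX Y hY
    _ = _ := by
        rw [← lintegral_const_mul' _ _ hc, ← lintegral_add_left]
        · refine lintegral_congr fun X => ?_
          rw [← lintegral_const_mul' _ _ hc, lintegral_add_left (by fun_prop)]
        · exact Measurable.const_mul (Measurable.lintegral_prod_right'
            (f := fun z : HalfAmbient n × HalfAmbient n => k z.1 z.2 * f z.2 * g z.1)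
            (by fun_prop)) _

theorem exists_lintegral_weightedKernel_bilinear_le {x y a b l : ℝ} (hy : 0 < y) (hyx : y < x)
    (hx : x < 1) (hab : b ≤ a) (hb : -y < b) (ha : a < 1 - x) (hl0 : 0 < l)
    (hl : l = (n + 1) * (1 - x + y) + b - a) :
    ∃ C : ℝ≥0∞, C ≠ ⊤ ∧ ∀ φ ψ : HalfAmbient n → ℝ≥0∞, Measurable φ → Measurable ψ →
      ∫⁻ Y in halfSpace n, φ Y ≤ 1 → ∫⁻ X in halfSpace n, ψ X ≤ 1 →
      ∫⁻ X in halfSpace n, ∫⁻ Y in halfSpace n,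
        weightedKernel a b l X Y * φ Y ^ x * ψ X ^ (1 - y) ≤ C := by
  obtain ⟨α₁, α₂, d, hd⟩ := exists_schurExponents hy hx hb ha hl0 hl
  obtain ⟨C₁, hC₁, hA⟩ := exists_lintegral_schurMajorant_le hd.neg_one_lt_fst hd.fst_lt
  obtain ⟨C₂, hC₂, hB⟩ := exists_lintegral_schurMajorant_le hd.neg_one_lt_snd hd.snd_lt
  obtain ⟨C₃, hC₃, hHLS⟩ := exists_setLIntegral_hardyLittlewoodSobolev
    (volume : Measure (HalfAmbient n)) measurableSet_halfSpace (hy.trans hyx) hx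
    (by linarith : 0 < 1 - y) (by linarith) (by linarith)
  rw [finrank_halfAmbient, show -((n + 1 : ℝ) * (2 - x - (1 - y))) = -l + (b - a) by rw [hl]; ring]
    at hHLS
  have hkernel : ∀ X ∈ halfSpace n, ∀ Y ∈ halfSpace n, weightedKernel a b l X Y ≤
      ENNReal.ofReal (2 ^ |a|) * ENNReal.ofReal (‖X - Y‖ ^ (-l + (b - a))) +
        schurMajorant α₁ d X Y ^ y * schurMajorant α₂ d Y X ^ (1 - x) :=
    fun X hX Y hY => (lt_or_ge (2 * ‖X - Y‖) (height X)).elim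
      (fun hnear => le_add_right (weightedKernel_le_of_near hab hl0 hX hY hnear))
      (fun hfar => le_add_left (weightedKernel_le_of_far hy.le hx.le hd hX hY hfar))
  refine ⟨ENNReal.ofReal (2 ^ |a|) * C₃ + C₁ ^ y * C₂ ^ (1 - x), ENNReal.add_ne_top.2
    ⟨ENNReal.mul_ne_top ENNReal.ofReal_ne_top hC₃, ENNReal.mul_ne_top
      (ENNReal.rpow_ne_top_of_nonneg hy.le hC₁)
      (ENNReal.rpow_ne_top_of_nonneg (by linarith) hC₂)⟩, fun φ ψ hφ hψ iφ iψ => ?_⟩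
  have hfar := lintegral_bilinear_le_of_schur (A := schurMajorant α₁ d)
    (B := fun X Y => schurMajorant α₂ d Y X) hx.le hy.le hyx.le (by fun_prop) (by fun_prop)
    (ae_restrict_of_forall_mem measurableSet_halfSpace hA)
    (ae_restrict_of_forall_mem measurableSet_halfSpace hB) hφ hψ iφ iψ
  exact (setLIntegral_mul_mul_le_of_le_add
    (k := fun X Y => ENNReal.ofReal (‖X - Y‖ ^ (-l + (b - a))))
    (S := fun X Y => schurMajorant α₁ d X Y ^ y * schurMajorant α₂ d Y X ^ (1 - x))
    (f := fun Y => φ Y ^ x) (g := fun X => ψ X ^ (1 - y))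
    ENNReal.ofReal_ne_top hkernel (by fun_prop) (by fun_prop) (by fun_prop)).trans
    (add_le_add (mul_le_mul_right (hHLS φ ψ hφ hψ iφ iψ) _) hfar)

theorem exists_lintegral_weightedKernel_le {x y a b l : ℝ} (hy : 0 < y) (hyx : y < x) (hx : x < 1)
    (hab : b ≤ a) (hb : -y < b) (ha : a < 1 - x) (hl0 : 0 < l)
    (hl : l = (n + 1) * (1 - x + y) + b - a) :
    ∃ C : ℝ≥0∞, C ≠ ⊤ ∧ ∀ φ : HalfAmbient n → ℝ≥0∞, Measurable φ →
      (∫⁻ X in halfSpace n, (∫⁻ Y in halfSpace n, weightedKernel a b l X Y * φ Y ^ x) ^ y⁻¹) ^ y ≤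
        C * (∫⁻ Y in halfSpace n, φ Y) ^ x := by
  obtain ⟨C, hC, h⟩ := exists_lintegral_weightedKernel_bilinear_le hy hyx hx hab hb ha hl0 hl
  exact ⟨C + 1, by simp [hC], fun φ hφ => lintegral_operator_le_of_bilinear (hy.trans hyx) hy
    (hyx.trans hx) (by fun_prop) (by simp)
    (fun φ ψ hφ hψ iφ iψ => (h φ ψ hφ hψ iφ iψ).trans le_self_add) hφ⟩

theorem ofReal_height_rpow_div {X : HalfAmbient n} (hX : X ∈ halfSpace n) (e : ℝ) {z : ℝ}
    (hz : 0 < z) :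
    ENNReal.ofReal (height X ^ (e / z)) = ENNReal.ofReal (height X ^ e) ^ z⁻¹ := by
  have hX0 : 0 < height X := hX
  rw [ENNReal.ofReal_rpow_of_nonneg (by positivity) (by positivity), ← Real.rpow_mul hX0.le,
    div_eq_mul_inv]

theorem ofReal_height_rpow_mul_lintegral_riesz {X : HalfAmbient n} (hX : X ∈ halfSpace n)
    (a b l : ℝ) (F : HalfAmbient n → ℝ≥0∞) :
    ENNReal.ofReal (height X ^ b) *
        ∫⁻ Y in halfSpace n, ENNReal.ofReal (‖X - Y‖ ^ (-l)) * F Y =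
      ∫⁻ Y in halfSpace n, weightedKernel a b l X Y * (ENNReal.ofReal (height Y ^ a) * F Y) := by
  have hX0 : 0 < height X := hX
  rw [← lintegral_const_mul' _ _ ENNReal.ofReal_ne_top]
  refine setLIntegral_congr_fun measurableSet_halfSpace fun Y (hY : 0 < height Y) => ?_
  have hYpow : height Y ^ (-a) * height Y ^ a = 1 := by rw [← Real.rpow_add hY]; simp
  simp only [weightedKernel]
  rw [← mul_assoc, ← mul_assoc, ← ENNReal.ofReal_mul (by positivity),
    ← ENNReal.ofReal_mul (by positivity)]
  congr 2
  linear_combination -(height X ^ b * ‖X - Y‖ ^ (-l)) * hYpow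

/-- Exponents for which the weighted inequality of order `m` holds: `x`, `y` are the reciprocals of
the Lebesgue exponents and `t ^ a`, `t ^ b` the weights inside the norms. -/
structure RieszCond (n : ℕ) (m x y a b : ℝ) : Prop where
  y_pos : 0 < y
  lt : y < x
  x_lt_one : x < 1
  le : b ≤ a
  neg_lt : -y < b
  lt_sub : a < 1 - x
  scaling : (n + 1) * x + a - m = (n + 1) * y + b

theorem RieszCond.exists_wInt_le {m x y a b : ℝ} (h : RieszCond n m x y a b) (hm : m < n + 1)
    {c : ℝ≥0∞} (hc : c ≠ ⊤) :
    ∃ C : ℝ≥0∞, C ≠ ⊤ ∧ ∀ {V : Type} [NormedAddCommGroup V] (u : HalfAmbient n → ℝ)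
      (v : HalfAmbient n → V), Measurable (fun Y => ‖v Y‖ₑ) →
      (∀ X ∈ halfSpace n, ‖u X‖ₑ ≤
        c * ∫⁻ Y in halfSpace n, ENNReal.ofReal (‖X - Y‖ ^ (m - (n + 1))) * ‖v Y‖ₑ) →
      wInt (b / y) (1 / y) u ^ y ≤ C * wInt (a / x) (1 / x) v ^ x := by
  obtain ⟨hy, hyx, hx, hab, hb, ha, hscaling⟩ := h
  have hx0 : 0 < x := by linarith
  obtain ⟨C, hC, hkernel⟩ := exists_lintegral_weightedKernel_le (n := n) (l := n + 1 - m) hy hyx hx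
    hab hb ha (by linarith) (by linarith)
  refine ⟨c * C, ENNReal.mul_ne_top hc hC, fun {V} _ u v hv huv => ?_⟩
  set φ : HalfAmbient n → ℝ≥0∞ := fun Y =>
    ENNReal.ofReal (height Y ^ (a / x)) * ‖v Y‖ₑ ^ (1 / x) with hφ
  have hφx : ∀ Y ∈ halfSpace n, φ Y ^ x = ENNReal.ofReal (height Y ^ a) * ‖v Y‖ₑ := fun Y hY => by
    rw [hφ, ENNReal.mul_rpow_of_nonneg _ _ hx0.le, ofReal_height_rpow_div hY a hx0, one_div,
      ENNReal.rpow_inv_rpow hx0.ne', ENNReal.rpow_inv_rpow hx0.ne']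
  have hpotential : ∀ X ∈ halfSpace n, ENNReal.ofReal (height X ^ b) * ‖u X‖ₑ ≤
      c * ∫⁻ Y in halfSpace n, weightedKernel a b (n + 1 - m) X Y * φ Y ^ x := fun X hX => by
    rw [setLIntegral_congr_fun measurableSet_halfSpace fun Y hY =>
      congrArg (weightedKernel a b (n + 1 - m) X Y * ·) (hφx Y hY),
      ← ofReal_height_rpow_mul_lintegral_riesz hX, mul_left_comm, neg_sub]
    gcongr
    exact huv X hX
  calc wInt (b / y) (1 / y) u ^ y
      ≤ (∫⁻ X in halfSpace n, c ^ y⁻¹ *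
          (∫⁻ Y in halfSpace n, weightedKernel a b (n + 1 - m) X Y * φ Y ^ x) ^ y⁻¹) ^ y := by
        refine ENNReal.rpow_le_rpow
          (setLIntegral_mono' measurableSet_halfSpace fun X hX => ?_) hy.le
        rw [ofReal_height_rpow_div hX b hy, one_div,
          ← ENNReal.mul_rpow_of_nonneg _ _ (by positivity),
          ← ENNReal.mul_rpow_of_nonneg _ _ (by positivity)]
        exact ENNReal.rpow_le_rpow (hpotential X hX) (by positivity)
    _ = c * (∫⁻ X in halfSpace n,
          (∫⁻ Y in halfSpace n, weightedKernel a b (n + 1 - m) X Y * φ Y ^ x) ^ y⁻¹) ^ y := by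
        rw [lintegral_const_mul' _ _ (ENNReal.rpow_ne_top_of_nonneg (by positivity) hc),
          ENNReal.mul_rpow_of_nonneg _ _ hy.le, ENNReal.rpow_inv_rpow hy.ne']
    _ ≤ c * (C * wInt (a / x) (1 / x) v ^ x) := by gcongr; exact hkernel φ (by fun_prop)
    _ = c * C * wInt (a / x) (1 / x) v ^ x := (mul_assoc _ _ _).symm

end WeightedRiesz

section FirstOrder

variable {E : Type*} [NormedAddCommGroup E] [NormedSpace ℝ E]

theorem hasDerivAt_comp_add_smul {F : Type*} [NormedAddCommGroup F] [NormedSpace ℝ F] {f : E → F}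
    (hf : Differentiable ℝ f) (Z v : E) (s : ℝ) :
    HasDerivAt (fun s : ℝ => f (Z + s • v)) (fderiv ℝ f (Z + s • v) v) s := by
  have hline : HasDerivAt (fun s : ℝ => Z + s • v) v s := by
    simpa using ((hasDerivAt_id s).smul_const v).const_add Z
  exact (hf _).hasFDerivAt.comp_hasDerivAt s hline

theorem enorm_le_lintegral_fderiv_ray {F : Type*} [NormedAddCommGroup F] [NormedSpace ℝ F]
    {φ : E → F} (hφ : ContDiff ℝ 1 φ)
    (hc : HasCompactSupport φ) (X : E) {w : E} (hw0 : w ≠ 0) (hw1 : ‖w‖ ≤ 1) :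
    ‖φ X‖ₑ ≤ ∫⁻ s in Set.Ioi (0 : ℝ), ‖fderiv ℝ φ (X + s • w)‖ₑ := by
  set g : ℝ → F := fun s => φ (X + s • -w)
  have hg : ContDiff ℝ 1 g := hφ.comp (by fun_prop)
  have hgc : HasCompactSupport g := hc.comp_isClosedEmbedding
    ((Homeomorph.addLeft X).isClosedEmbedding.comp
      (isClosedEmbedding_smul_left (neg_ne_zero.2 hw0)))
  have hderiv : ∀ s, ‖deriv g s‖ₑ ≤ ‖fderiv ℝ φ (X + s • -w)‖ₑ := fun s => by
    rw [(hasDerivAt_comp_add_smul (hφ.differentiable one_ne_zero) X (-w) s).deriv,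
      enorm_le_iff_norm_le]
    exact (ContinuousLinearMap.le_opNorm _ _).trans
      (mul_le_of_le_one_right (norm_nonneg _) (by rwa [norm_neg]))
  calc ‖φ X‖ₑ = ‖g 0‖ₑ := by simp [g]
    _ ≤ ∫⁻ s in Set.Iic (0 : ℝ), ‖deriv g s‖ₑ := hgc.enorm_le_lintegral_Ici_deriv hg 0
    _ ≤ ∫⁻ s in Set.Iic (0 : ℝ), ‖fderiv ℝ φ (X + s • -w)‖ₑ := lintegral_mono fun s => hderiv s
    _ = ∫⁻ s in Set.Ici (0 : ℝ), ‖fderiv ℝ φ (X + s • w)‖ₑ := by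
        rw [← (Measure.measurePreserving_neg volume).setLIntegral_comp_preimage_emb
          (MeasurableEquiv.neg ℝ).measurableEmbedding]
        simp
    _ = _ := by rw [restrict_Ioi_eq_restrict_Ici]

theorem lintegral_lintegral_comp_smul [FiniteDimensional ℝ E] [MeasurableSpace E] [BorelSpace E]
    (μ : Measure E) [μ.IsAddHaarMeasure] {A : Set E} (hA : MeasurableSet A) {D : E → ℝ≥0∞}
    (hD : Measurable D) :
    ∫⁻ w in A, (∫⁻ s in Set.Ioi (0 : ℝ), D (s • w)) ∂μ =
      ∫⁻ Z, (∫⁻ s in Set.Ioi (0 : ℝ), ENNReal.ofReal (s ^ (-(Module.finrank ℝ E : ℝ))) *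
        A.indicator 1 (s⁻¹ • Z)) * D Z ∂μ := by
  have hscaled : Measurable fun z : ℝ × E => A.indicator (1 : E → ℝ≥0∞) (z.1⁻¹ • z.2) :=
    (measurable_const.indicator hA).comp (by fun_prop)
  have hpow : Measurable fun z : ℝ × E => ENNReal.ofReal (z.1 ^ (-(Module.finrank ℝ E : ℝ))) := by
    fun_prop
  calc _ = ∫⁻ s in Set.Ioi (0 : ℝ), ∫⁻ w in A, D (s • w) ∂μ :=
        lintegral_lintegral_swap (Measurable.aemeasurable (by fun_prop))
    _ = ∫⁻ s in Set.Ioi (0 : ℝ), ∫⁻ Z, ENNReal.ofReal (s ^ (-(Module.finrank ℝ E : ℝ))) *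
          A.indicator 1 (s⁻¹ • Z) * D Z ∂μ := by
        refine setLIntegral_congr_fun measurableSet_Ioi fun s (hs : 0 < s) => ?_
        rw [lintegral_eq_lintegral_comp_smul μ hs, ← lintegral_const_mul' _ _ ENNReal.ofReal_ne_top,
          ← lintegral_indicator hA]
        refine lintegral_congr fun w => ?_
        rw [inv_smul_smul₀ hs.ne', ← mul_assoc, ← mul_assoc, ofReal_rpow_mul_ofReal_rpow hs]
        by_cases hw : w ∈ A <;> simp [hw]
    _ = ∫⁻ Z, (∫⁻ s in Set.Ioi (0 : ℝ), ENNReal.ofReal (s ^ (-(Module.finrank ℝ E : ℝ))) *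
          A.indicator 1 (s⁻¹ • Z) * D Z) ∂μ :=
        lintegral_lintegral_swap ((hpow.mul hscaled).mul (by fun_prop)).aemeasurable
    _ = _ := lintegral_congr fun Z => lintegral_mul_const _
        ((hpow.mul hscaled).comp measurable_prodMk_right)

variable {n : ℕ}

theorem enorm_gradient (f : HalfAmbient n → ℝ) (X : HalfAmbient n) :
    ‖∇ f X‖ₑ = ‖fderiv ℝ f X‖ₑ := by
  rw [enorm_eq_iff_norm_eq, gradient, LinearIsometryEquiv.norm_map]

/-- The set of upward directions along which the fundamental theorem of calculus is averaged; rays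
in these directions issued from a point of the half space stay in the half space. -/
def upperShell (n : ℕ) : Set (HalfAmbient n) := {w | 1 / 2 < ‖w‖ ∧ ‖w‖ < 1 ∧ 0 < height w}

theorem isOpen_upperShell : IsOpen (upperShell n) :=
  (isOpen_lt continuous_const continuous_norm).inter
    ((isOpen_lt continuous_norm continuous_const).inter
      (isOpen_lt continuous_const continuous_height))

theorem volume_upperShell_ne_zero : volume (upperShell n) ≠ 0 := by
  refine (isOpen_upperShell.measure_pos volume ⟨(3 / 4 : ℝ) • eLast n, ?_⟩).ne'
  simp only [upperShell, Set.mem_ofPred_eq, norm_smul, norm_eLast, height_smul, height_eLast]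
  norm_num [abs_of_pos]

theorem volume_upperShell_ne_top : volume (upperShell n) ≠ ⊤ := by
  refine ne_top_of_le_ne_top (measure_ball_lt_top (x := (0 : HalfAmbient n)) (r := 1)).ne
    (measure_mono fun w hw => ?_)
  simpa using hw.2.1

theorem inv_smul_mem_upperShell {s : ℝ} (hs : 0 < s) {Z : HalfAmbient n} :
    s⁻¹ • Z ∈ upperShell n ↔ s ∈ Set.Ioo ‖Z‖ (2 * ‖Z‖) ∧ Z ∈ halfSpace n := by
  simp only [upperShell, halfSpace, Set.mem_ofPred_eq, norm_smul, height_smul, norm_inv,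
    Real.norm_of_nonneg hs.le, Set.mem_Ioo, inv_mul_eq_div, div_lt_one hs,
    div_pos_iff_of_pos_right hs, lt_div_iff₀ hs]
  grind

theorem lintegral_indicator_upperShell_le (Z : HalfAmbient n) :
    ∫⁻ s in Set.Ioi (0 : ℝ), ENNReal.ofReal (s ^ (-(n + 1 : ℝ))) *
        (upperShell n).indicator 1 (s⁻¹ • Z) ≤
      (halfSpace n).indicator (fun Z => ENNReal.ofReal (‖Z‖ ^ (1 - (n + 1 : ℝ)))) Z := by
  by_cases hZ : Z ∈ halfSpace n
  · have hZ0 : 0 < ‖Z‖ := ((show 0 < height Z from hZ).trans_le (le_abs_self _)).trans_le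
      (abs_height_le Z)
    calc _ ≤ ∫⁻ s in Set.Ioi (0 : ℝ), (Set.Ioo ‖Z‖ (2 * ‖Z‖)).indicator
            (fun _ => ENNReal.ofReal (‖Z‖ ^ (-(n + 1 : ℝ)))) s := by
          refine setLIntegral_mono' measurableSet_Ioi fun s hs => ?_
          by_cases hmem : s⁻¹ • Z ∈ upperShell n
          · have hsZ := ((inv_smul_mem_upperShell hs).1 hmem).1
            rw [Set.indicator_of_mem hmem, Set.indicator_of_mem hsZ, Pi.one_apply, mul_one]
            exact ENNReal.ofReal_le_ofReal
              (Real.rpow_le_rpow_of_nonpos hZ0 hsZ.1.le (by linarith))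
          · rw [Set.indicator_of_notMem hmem, mul_zero]; exact bot_le
      _ ≤ ENNReal.ofReal (‖Z‖ ^ (-(n + 1 : ℝ))) * ENNReal.ofReal (2 * ‖Z‖ - ‖Z‖) := by
          refine (setLIntegral_le_lintegral _ _).trans ?_
          rw [lintegral_indicator measurableSet_Ioo, setLIntegral_const, Real.volume_Ioo]
      _ = ENNReal.ofReal (‖Z‖ ^ (1 - (n + 1 : ℝ))) := by
          rw [← ENNReal.ofReal_mul (by positivity), sub_eq_neg_add 1 (n + 1 : ℝ),
            Real.rpow_add hZ0, Real.rpow_one]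
          congr 2; ring
      _ = _ := by rw [Set.indicator_of_mem hZ]
  · rw [setLIntegral_congr_fun measurableSet_Ioi (g := 0) fun s hs => ?_]
    · simp
    · rw [Set.indicator_of_notMem fun h => hZ ((inv_smul_mem_upperShell hs).1 h).2, mul_zero,
        Pi.zero_apply]

theorem exists_enorm_le_riesz_one (n : ℕ) : ∃ c : ℝ≥0∞, c ≠ ⊤ ∧ ∀ φ : HalfAmbient n → ℝ,
    ContDiff ℝ 1 φ → HasCompactSupport φ → ∀ X ∈ halfSpace n, ‖φ X‖ₑ ≤
      c * ∫⁻ Y in halfSpace n, ENNReal.ofReal (‖X - Y‖ ^ (1 - (n + 1 : ℝ))) * ‖∇ φ Y‖ₑ := by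
  refine ⟨(volume (upperShell n))⁻¹, ENNReal.inv_ne_top.2 volume_upperShell_ne_zero,
    fun φ hφ hc X hX => ?_⟩
  rw [mul_comm, ← div_eq_mul_inv,
    ENNReal.le_div_iff_mul_le (Or.inl volume_upperShell_ne_zero) (Or.inl volume_upperShell_ne_top)]
  simp_rw [enorm_gradient]
  set D : HalfAmbient n → ℝ≥0∞ := fun Y => ‖fderiv ℝ φ Y‖ₑ
  have hD : Measurable D := (hφ.continuous_fderiv one_ne_zero).enorm.measurable
  have hA : MeasurableSet (upperShell n) := isOpen_upperShell.measurableSet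
  set k : HalfAmbient n → ℝ≥0∞ :=
    (halfSpace n).indicator fun Z => ENNReal.ofReal (‖Z‖ ^ (1 - (n + 1 : ℝ)))
  calc ‖φ X‖ₑ * volume (upperShell n) = ∫⁻ _ in upperShell n, ‖φ X‖ₑ :=
        (setLIntegral_const _ _).symm
    _ ≤ ∫⁻ w in upperShell n, ∫⁻ s in Set.Ioi (0 : ℝ), D (X + s • w) :=
        setLIntegral_mono' hA fun w hw => enorm_le_lintegral_fderiv_ray hφ hc X
          (norm_pos_iff.1 (by linarith [hw.1])) hw.2.1.le
    _ ≤ ∫⁻ Z, k Z * D (X + Z) := by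
        rw [lintegral_lintegral_comp_smul volume hA (D := fun Z => D (X + Z)) (by fun_prop),
          finrank_halfAmbient]
        gcongr with Z
        exact lintegral_indicator_upperShell_le Z
    _ = ∫⁻ Y, k (Y - X) * D Y := by
        rw [← lintegral_sub_right_eq_self _ X]
        simp
    _ ≤ ∫⁻ Y in halfSpace n, ENNReal.ofReal (‖X - Y‖ ^ (1 - (n + 1 : ℝ))) * D Y := by
        rw [← lintegral_indicator measurableSet_halfSpace]
        refine lintegral_mono fun Y => ?_
        by_cases hY : Y - X ∈ halfSpace n
        · have hY' : 0 < height Y - height X := hY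
          have hY0 : Y ∈ halfSpace n := (show 0 < height X from hX).trans (sub_pos.1 hY')
          rw [Set.indicator_of_mem hY0, norm_sub_rev]
          simp only [k, Set.indicator_of_mem hY, le_refl]
        · simp only [k, Set.indicator_of_notMem hY, zero_mul, zero_le]

end FirstOrder

section Folding

theorem hasDerivAt_of_eqOn_Ici_of_eqOn_Iic {g h k : ℝ → ℝ} {a c s : ℝ}
    (hgh : Set.EqOn g h (Set.Ici a)) (hgk : Set.EqOn g k (Set.Iic a))
    (hh : a ≤ s → HasDerivAt h c s) (hk : s ≤ a → HasDerivAt k c s) : HasDerivAt g c s := by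
  have hright : HasDerivWithinAt g c (Set.Ici a) s := by
    by_cases hs : a ≤ s
    · exact (hh hs).hasDerivWithinAt.congr hgh (hgh hs)
    · have hmem : s ∉ closure (Set.Ici a) := by rwa [closure_Ici]
      exact hasDerivWithinAt_iff_hasFDerivWithinAt.2 (.of_notMem_closure hmem)
  have hleft : HasDerivWithinAt g c (Set.Iic a) s := by
    by_cases hs : s ≤ a
    · exact (hk hs).hasDerivWithinAt.congr hgk (hgk hs)
    · have hmem : s ∉ closure (Set.Iic a) := by rwa [closure_Iic]
      exact hasDerivWithinAt_iff_hasFDerivWithinAt.2 (.of_notMem_closure hmem)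
  simpa [Set.Iic_union_Ici] using hleft.union hright

theorem hasDerivAt_comp_abs {h h' : ℝ → ℝ} (hd : ∀ s, HasDerivAt h (h' s) s) (h0 : h' 0 = 0)
    (s : ℝ) : HasDerivAt (fun s => h |s|) ((if 0 ≤ s then 1 else -1) * h' |s|) s := by
  refine hasDerivAt_of_eqOn_Ici_of_eqOn_Iic (a := 0) (h := h) (k := fun s => h (-s))
    (fun s hs => by rw [abs_of_nonneg hs]) (fun s hs => by rw [abs_of_nonpos hs])
    (fun hs => ?_) (fun hs => ?_)
  · simpa [hs, abs_of_nonneg hs] using hd s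
  · have hneg : HasDerivAt (fun s => h (-s)) (h' (-s) * -1) s :=
      (hd (-s)).comp s (hasDerivAt_neg s)
    rcases hs.eq_or_lt with rfl | hs
    · simpa [h0] using hneg
    · simpa [hs.not_ge, abs_of_neg hs] using hneg

theorem hasDerivAt_sign_mul_comp_abs {h h' : ℝ → ℝ} (hd : ∀ s, HasDerivAt h (h' s) s)
    (h0 : h 0 = 0) (s : ℝ) :
    HasDerivAt (fun s => (if 0 ≤ s then 1 else -1) * h |s|) (h' |s|) s := by
  refine hasDerivAt_of_eqOn_Ici_of_eqOn_Iic (a := 0) (h := h) (k := fun s => -h (-s))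
    (fun s (hs : 0 ≤ s) => by simp [hs, abs_of_nonneg hs]) (fun s (hs : s ≤ 0) => ?_)
    (fun hs => by simpa [abs_of_nonneg hs] using hd s) (fun hs => ?_)
  · rcases hs.eq_or_lt with rfl | hs
    · simp [h0]
    · simp [hs.not_ge, abs_of_neg hs]
  · have hneg : HasDerivAt (fun s => -h (-s)) (-(h' (-s) * -1)) s :=
      ((hd (-s)).comp s (hasDerivAt_neg s)).neg
    simpa [abs_of_nonpos hs] using hneg

variable {n : ℕ}

/-- The folding map `(x, t) ↦ (x, |t|)`; composing with it extends a function on the closed half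
space evenly to the whole space. -/
noncomputable def fold (X : HalfAmbient n) : HalfAmbient n := bdryProj X + |height X| • eLast n

@[fun_prop]
theorem continuous_fold : Continuous (fold : HalfAmbient n → HalfAmbient n) := by
  unfold fold; fun_prop

theorem fold_of_nonneg {X : HalfAmbient n} (hX : 0 ≤ height X) : fold X = X := by
  simp [fold, bdryProj, abs_of_nonneg hX]

theorem fold_apply (X : HalfAmbient n) (i : Fin (n + 1)) :
    fold X i = if i = Fin.last n then |X i| else X i := by
  by_cases h : i = Fin.last n
  · subst h; simp [fold, bdryProj, eLast, height]
  · simp [fold, bdryProj, eLast, height, h]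

theorem norm_fold (X : HalfAmbient n) : ‖fold X‖ = ‖X‖ := by
  simp_rw [EuclideanSpace.norm_eq, fold_apply, apply_ite norm, Real.norm_eq_abs, abs_abs, ite_self]

theorem norm_fold_sub_le {X : HalfAmbient n} (hX : 0 ≤ height X) (Y : HalfAmbient n) :
    ‖fold Y - X‖ ≤ ‖Y - X‖ := by
  rw [← sq_le_sq₀ (norm_nonneg _) (norm_nonneg _), EuclideanSpace.norm_sq_eq,
    EuclideanSpace.norm_sq_eq]
  refine Finset.sum_le_sum fun i _ => ?_
  rw [PiLp.sub_apply, PiLp.sub_apply, fold_apply, sq_le_sq, Real.norm_eq_abs, Real.norm_eq_abs,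
    abs_abs, abs_abs]
  split_ifs with h
  · have hXi : |X i| = X i := abs_of_nonneg (h ▸ hX)
    simpa only [hXi] using abs_abs_sub_abs_le_abs_sub (Y i) (X i)
  · exact le_rfl

theorem hasCompactSupport_comp_fold {M : Type*} [Zero M] {F : HalfAmbient n → M}
    (hF : HasCompactSupport F) : HasCompactSupport (F ∘ fold) := by
  obtain ⟨R, hR⟩ := hF.isCompact.isBounded.subset_closedBall 0
  refine HasCompactSupport.intro (isCompact_closedBall (0 : HalfAmbient n) R) fun X hX => ?_
  refine image_eq_zero_of_notMem_tsupport (f := F) fun h => hX ?_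
  rw [mem_closedBall_zero_iff, ← norm_fold, ← mem_closedBall_zero_iff]
  exact hR h

/-- The reflection `(x, t) ↦ (x, -t)`. -/
noncomputable def reflectHeight (n : ℕ) : HalfAmbient n ≃ₗᵢ[ℝ] HalfAmbient n :=
  LinearIsometryEquiv.piLpCongrRight 2 fun i : Fin (n + 1) =>
    if i = Fin.last n then LinearIsometryEquiv.neg ℝ else LinearIsometryEquiv.refl ℝ ℝ

theorem reflectHeight_apply (X : HalfAmbient n) (i : Fin (n + 1)) :
    reflectHeight n X i = if i = Fin.last n then -X i else X i := by
  by_cases h : i = Fin.last n <;> simp [reflectHeight, h]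

theorem fold_reflectHeight (X : HalfAmbient n) : fold (reflectHeight n X) = fold X := by
  ext i
  rw [fold_apply, fold_apply, reflectHeight_apply]
  split_ifs <;> simp

theorem volume_height_eq_zero : volume {X : HalfAmbient n | height X = 0} = 0 := by
  have hker := Measure.addHaar_submodule (volume : Measure (HalfAmbient n))
    (LinearMap.ker (EuclideanSpace.proj (𝕜 := ℝ) (Fin.last n)).toLinearMap) fun htop => by
      have hmem : eLast n ∈ (⊤ : Submodule ℝ (HalfAmbient n)) := trivial
      rw [← htop] at hmem
      simp [eLast] at hmem
  convert hker using 2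
  ext X
  simp [height]

theorem univ_subset_halfSpace_union_reflectHeight :
    (Set.univ : Set (HalfAmbient n)) ⊆
      (halfSpace n ∪ reflectHeight n ⁻¹' halfSpace n) ∪ {X | height X = 0} := by
  intro X _
  have hreflect : height (reflectHeight n X) = -height X := by
    rw [height, reflectHeight_apply, if_pos rfl, height]
  simp only [halfSpace, Set.mem_union, Set.mem_preimage, Set.mem_ofPred_eq, hreflect, neg_pos]
  grind

theorem lintegral_comp_fold_le (H : HalfAmbient n → ℝ≥0∞) :
    ∫⁻ Y, H (fold Y) ≤ 2 * ∫⁻ Y in halfSpace n, H Y := by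
  have hupper : ∫⁻ Y in halfSpace n, H (fold Y) = ∫⁻ Y in halfSpace n, H Y :=
    setLIntegral_congr_fun measurableSet_halfSpace fun Y hY => by
      rw [fold_of_nonneg (le_of_lt hY)]
  have hlower : ∫⁻ Y in reflectHeight n ⁻¹' halfSpace n, H (fold Y) =
      ∫⁻ Y in halfSpace n, H Y := by
    have hreflect := (reflectHeight n).measurePreserving.setLIntegral_comp_preimage_emb
      (reflectHeight n).toHomeomorph.measurableEmbedding (fun Y => H (fold Y)) (halfSpace n)
    simp only [fold_reflectHeight] at hreflect
    rw [hreflect, hupper]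
  calc ∫⁻ Y, H (fold Y) = ∫⁻ Y in Set.univ, H (fold Y) := setLIntegral_univ _ |>.symm
    _ ≤ (∫⁻ Y in halfSpace n ∪ reflectHeight n ⁻¹' halfSpace n, H (fold Y)) +
          ∫⁻ Y in {X : HalfAmbient n | height X = 0}, H (fold Y) :=
        (lintegral_mono_set univ_subset_halfSpace_union_reflectHeight).trans
          (lintegral_union_le _ _ _)
    _ = ∫⁻ Y in halfSpace n ∪ reflectHeight n ⁻¹' halfSpace n, H (fold Y) := by
        rw [setLIntegral_measure_zero _ _ volume_height_eq_zero, add_zero]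
    _ ≤ 2 * ∫⁻ Y in halfSpace n, H Y := by
        refine (lintegral_union_le _ _ _).trans_eq ?_
        rw [hupper, hlower, two_mul]

/-- The coordinate directions of `ℝ^(n+1)`. -/
noncomputable def coordVec (i : Fin (n + 1)) : HalfAmbient n := EuclideanSpace.single i 1

theorem coordVec_last : coordVec (Fin.last n) = eLast n := rfl

/-- The sign produced by differentiating in the `i`-th coordinate through the folding map. -/
noncomputable def foldSign (i : Fin (n + 1)) (X : HalfAmbient n) : ℝ :=
  if i = Fin.last n then if 0 ≤ height X then 1 else -1 else 1

theorem abs_foldSign (i : Fin (n + 1)) (X : HalfAmbient n) : |foldSign i X| = 1 := by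
  unfold foldSign
  split_ifs <;> simp

theorem measurable_foldSign (i : Fin (n + 1)) : Measurable (foldSign i : HalfAmbient n → ℝ) :=
  .ite (.const _) (.ite (measurableSet_le measurable_const measurable_height) measurable_const
    measurable_const) measurable_const

theorem fold_add_smul_coordVec {i : Fin (n + 1)} (hi : i ≠ Fin.last n) (X : HalfAmbient n) (s : ℝ) :
    fold (X + s • coordVec i) = fold X + s • coordVec i := by
  ext j
  rw [fold_apply, PiLp.add_apply, PiLp.add_apply, fold_apply]
  split_ifs with hj
  · subst hj; simp [coordVec, hi.symm]
  · rfl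

theorem fold_add_smul_eLast (X : HalfAmbient n) (s : ℝ) :
    fold (X + s • eLast n) = bdryProj X + |height X + s| • eLast n := by
  simp [fold, bdryProj, add_smul]

theorem hasLineDerivAt_comp_fold {f : HalfAmbient n → ℝ} (hf : Differentiable ℝ f)
    (hb : ∀ X, height X = 0 → fderiv ℝ f X (eLast n) = 0) (i : Fin (n + 1)) (X : HalfAmbient n) :
    HasLineDerivAt ℝ (fun X => f (fold X)) (foldSign i X * fderiv ℝ f (fold X) (coordVec i)) X
      (coordVec i) := by
  unfold HasLineDerivAt
  by_cases hi : i = Fin.last n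
  · subst hi
    have h := (hasDerivAt_comp_abs
      (hasDerivAt_comp_add_smul hf (bdryProj X) (eLast n)) (by simp [hb])
      (height X + 0)).comp_const_add (height X) 0
    rw [add_zero, ← fold] at h
    simpa only [foldSign, ↓reduceIte, coordVec_last, fold_add_smul_eLast, add_zero] using h
  · simp_rw [foldSign, if_neg hi, fold_add_smul_coordVec hi, one_mul]
    simpa using hasDerivAt_comp_add_smul hf (fold X) (coordVec i) 0

theorem hasLineDerivAt_foldSign_mul_comp_fold {f : HalfAmbient n → ℝ} (hf : Differentiable ℝ f)
    (i : Fin (n + 1)) (hb : i = Fin.last n → ∀ X, height X = 0 → f X = 0) (X : HalfAmbient n) :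
    HasLineDerivAt ℝ (fun X => foldSign i X * f (fold X)) (fderiv ℝ f (fold X) (coordVec i)) X
      (coordVec i) := by
  unfold HasLineDerivAt
  by_cases hi : i = Fin.last n
  · subst hi
    have h := (hasDerivAt_sign_mul_comp_abs
      (hasDerivAt_comp_add_smul hf (bdryProj X) (eLast n)) (by simp [hb])
      (height X + 0)).comp_const_add (height X) 0
    rw [add_zero, ← fold] at h
    simpa only [foldSign, ↓reduceIte, coordVec_last, fold_add_smul_eLast, height_add, height_smul,
      height_eLast, mul_one, add_zero] using h
  · simp_rw [foldSign, if_neg hi, fold_add_smul_coordVec hi, one_mul]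
    simpa using hasDerivAt_comp_add_smul hf (fold X) (coordVec i) 0

end Folding

section SecondOrder

variable {n : ℕ}

theorem hasLineDerivAt_norm_sq_add (X Y : HalfAmbient n) (c : ℝ) (i : Fin (n + 1)) :
    HasLineDerivAt ℝ (fun Y => ‖Y - X‖ ^ 2 + c) (2 * (Y - X) i) Y (coordVec i) := by
  have hexpand (s : ℝ) : ‖Y + s • coordVec i - X‖ ^ 2 + c =
      ‖Y - X‖ ^ 2 + s * (2 * (Y - X) i) + s ^ 2 + c := by
    rw [add_sub_right_comm, norm_add_sq_real, inner_smul_right, norm_smul, coordVec,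
      EuclideanSpace.inner_single_right]
    simp
    ring
  simp_rw [HasLineDerivAt, hexpand]
  simpa using ((((hasDerivAt_id (0 : ℝ)).mul_const (2 * (Y - X) i)).const_add (‖Y - X‖ ^ 2)).add
    ((hasDerivAt_id (0 : ℝ)).pow 2)).add_const c

theorem hasLineDerivAt_norm_sq_add_rpow (X Y : HalfAmbient n) {c : ℝ} (hc : 0 < c) (e : ℝ)
    (i : Fin (n + 1)) :
    HasLineDerivAt ℝ (fun Y => (‖Y - X‖ ^ 2 + c) ^ e)
      (2 * e * (Y - X) i * (‖Y - X‖ ^ 2 + c) ^ (e - 1)) Y (coordVec i) := by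
  refine ((hasLineDerivAt_norm_sq_add X Y c i).rpow_const (p := e)
    (Or.inl (by positivity))).congr_deriv ?_
  simp only [zero_smul, add_zero]
  ring

theorem hasLineDerivAt_coord_mul_norm_sq_add_rpow (X Y : HalfAmbient n) {c : ℝ} (hc : 0 < c) (e : ℝ)
    (i : Fin (n + 1)) :
    HasLineDerivAt ℝ (fun Y => 2 * e * (Y - X) i * (‖Y - X‖ ^ 2 + c) ^ (e - 1))
      (2 * e * (‖Y - X‖ ^ 2 + c) ^ (e - 1) +
        4 * e * (e - 1) * (Y - X) i ^ 2 * (‖Y - X‖ ^ 2 + c) ^ (e - 2)) Y (coordVec i) := by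
  have hcoord : HasDerivAt (fun s : ℝ => 2 * e * (Y + s • coordVec i - X) i) (2 * e) 0 := by
    have hlin (s : ℝ) : 2 * e * (Y + s • coordVec i - X) i =
        2 * e * (Y - X) i + s * (2 * e) := by
      simp only [coordVec, PiLp.sub_apply, PiLp.add_apply, PiLp.smul_apply,
        PiLp.single_apply, ↓reduceIte, smul_eq_mul, mul_one]
      ring
    simp_rw [hlin]
    simpa using ((hasDerivAt_id (0 : ℝ)).mul_const (2 * e)).const_add (2 * e * (Y - X) i)
  refine (hcoord.mul (hasLineDerivAt_norm_sq_add_rpow X Y hc (e - 1) i)).congr_deriv ?_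
  simp only [zero_smul, add_zero]
  rw [show e - 1 - 1 = e - 2 by ring]
  ring

@[fun_prop]
theorem continuous_norm_sq_add_rpow (X : HalfAmbient n) {c : ℝ} (hc : 0 < c) (e : ℝ) :
    Continuous fun Y : HalfAmbient n => (‖Y - X‖ ^ 2 + c) ^ e :=
  Continuous.rpow_const (by fun_prop) fun Y => Or.inl (by positivity)

theorem integrable_comp_fold_mul {f g : HalfAmbient n → ℝ} (hf : Continuous f)
    (hfc : HasCompactSupport f) (hg : Continuous g) : Integrable fun Y => f (fold Y) * g Y :=
  Continuous.integrable_of_hasCompactSupport (by fun_prop)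
    ((hasCompactSupport_comp_fold hfc).mul_right (f' := g))

theorem integrable_foldSign_mul_comp_fold_mul (i : Fin (n + 1)) {f g : HalfAmbient n → ℝ}
    (hf : Continuous f) (hfc : HasCompactSupport f) (hg : Continuous g) :
    Integrable fun Y => foldSign i Y * f (fold Y) * g Y := by
  simp_rw [mul_assoc]
  exact (integrable_comp_fold_mul hf hfc hg).bdd_mul (c := 1)
    (measurable_foldSign i).aestronglyMeasurable
    (Eventually.of_forall fun Y => (abs_foldSign i Y).le)

/-- The partial derivative of `f` in the `i`-th coordinate. -/
noncomputable def coordDeriv (i : Fin (n + 1)) (f : HalfAmbient n → ℝ) (X : HalfAmbient n) : ℝ :=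
  fderiv ℝ f X (coordVec i)

theorem contDiff_coordDeriv {f : HalfAmbient n → ℝ} (hf : ContDiff ℝ ∞ f) (i : Fin (n + 1)) :
    ContDiff ℝ ∞ (coordDeriv i f) :=
  (hf.fderiv_right (m := ∞) (by simp)).clm_apply contDiff_const

theorem hasCompactSupport_coordDeriv {f : HalfAmbient n → ℝ} (hf : HasCompactSupport f)
    (i : Fin (n + 1)) : HasCompactSupport (coordDeriv i f) :=
  hf.fderiv_apply ℝ _

theorem laplacian_eq_sum_coordDeriv {φ : HalfAmbient n → ℝ} (hφ : ContDiff ℝ ∞ φ)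
    (Y : HalfAmbient n) : (Δ φ) Y = ∑ i, coordDeriv i (coordDeriv i φ) Y := by
  have hd : Differentiable ℝ (fderiv ℝ φ) :=
    (hφ.fderiv_right (m := ∞) (by simp)).differentiable (by simp)
  rw [InnerProductSpace.laplacian_eq_iteratedFDeriv_orthonormalBasis φ
    (EuclideanSpace.basisFun (Fin (n + 1)) ℝ)]
  refine Finset.sum_congr rfl fun i _ => ?_
  unfold coordDeriv
  rw [iteratedFDeriv_two_apply, fderiv_clm_apply (hd Y) (differentiableAt_const _)]
  simp [coordVec]

-- The Neumann condition removes the boundary term of the integration by parts for `i = Fin.last n`.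
theorem integral_comp_fold_mul_eq_integral_coordDeriv_comp_fold_mul {φ : HalfAmbient n → ℝ}
    (hφ : ContDiff ℝ ∞ φ) (hc : HasCompactSupport φ)
    (hb : ∀ X, height X = 0 → fderiv ℝ φ X (eLast n) = 0) (i : Fin (n + 1))
    {g g' g'' : HalfAmbient n → ℝ} (hg : Continuous g) (hg' : Continuous g') (hg'' : Continuous g'')
    (hderiv : ∀ Y, HasLineDerivAt ℝ g (g' Y) Y (coordVec i))
    (hderiv' : ∀ Y, HasLineDerivAt ℝ g' (g'' Y) Y (coordVec i)) :
    ∫ Y, φ (fold Y) * g'' Y = ∫ Y, coordDeriv i (coordDeriv i φ) (fold Y) * g Y := by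
  have hφ₁ := contDiff_coordDeriv hφ i
  have hc₁ := hasCompactSupport_coordDeriv hc i
  have hφ₂ := contDiff_coordDeriv hφ₁ i
  have hc₂ := hasCompactSupport_coordDeriv hc₁ i
  have hparts₁ : ∫ Y, φ (fold Y) * g'' Y =
      -∫ Y, foldSign i Y * coordDeriv i φ (fold Y) * g' Y :=
    integral_bilinear_hasLineDerivAt_right_eq_neg_left_of_integrable
      (B := ContinuousLinearMap.mul ℝ ℝ) (v := coordVec i)
      (integrable_foldSign_mul_comp_fold_mul i hφ₁.continuous hc₁ hg')
      (integrable_comp_fold_mul hφ.continuous hc hg'')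
      (integrable_comp_fold_mul hφ.continuous hc hg')
      (fun Y _ => hasLineDerivAt_comp_fold (hφ.differentiable (by simp)) hb i Y)
      (fun Y _ => hderiv' Y)
  have hparts₂ : ∫ Y, foldSign i Y * coordDeriv i φ (fold Y) * g' Y =
      -∫ Y, coordDeriv i (coordDeriv i φ) (fold Y) * g Y :=
    integral_bilinear_hasLineDerivAt_right_eq_neg_left_of_integrable
      (B := ContinuousLinearMap.mul ℝ ℝ) (v := coordVec i)
      (integrable_comp_fold_mul hφ₂.continuous hc₂ hg)
      (integrable_foldSign_mul_comp_fold_mul i hφ₁.continuous hc₁ hg')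
      (integrable_foldSign_mul_comp_fold_mul i hφ₁.continuous hc₁ hg)
      (fun Y _ => hasLineDerivAt_foldSign_mul_comp_fold (hφ₁.differentiable (by simp)) i
        (fun hi Z hZ => by subst hi; exact hb Z hZ) Y)
      (fun Y _ => hderiv Y)
  rw [hparts₁, hparts₂, neg_neg]

/-- The regularization `(‖Z‖² + c) ^ ((1 - n) / 2)` of the Newton kernel of `ℝ^(n+1)`, up to a
normalizing constant. -/
noncomputable def regNewton (c : ℝ) (Z : HalfAmbient n) : ℝ := (‖Z‖ ^ 2 + c) ^ ((1 - n : ℝ) / 2)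

/-- The function `-Δ (regNewton c)`, an approximate identity as `c → 0`, up to a normalizing
constant. -/
noncomputable def negLapRegNewton (c : ℝ) (Z : HalfAmbient n) : ℝ :=
  (n - 1) * (n + 1) * c * (‖Z‖ ^ 2 + c) ^ (-(n + 3 : ℝ) / 2)

theorem sum_coord_norm_sq_add_rpow (X Y : HalfAmbient n) {c e : ℝ} (hc : 0 < c)
    (he : e = (1 - n) / 2) :
    ∑ i : Fin (n + 1), (2 * e * (‖Y - X‖ ^ 2 + c) ^ (e - 1) +
      4 * e * (e - 1) * (Y - X) i ^ 2 * (‖Y - X‖ ^ 2 + c) ^ (e - 2)) =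
      -negLapRegNewton c (Y - X) := by
  have hsq : ∑ i : Fin (n + 1), (Y - X) i ^ 2 = ‖Y - X‖ ^ 2 := by
    rw [EuclideanSpace.norm_sq_eq]; simp
  have hpow : (‖Y - X‖ ^ 2 + c) ^ (e - 1) =
      (‖Y - X‖ ^ 2 + c) ^ (e - 2) * (‖Y - X‖ ^ 2 + c) := by
    rw [← Real.rpow_add_one (by positivity)]; congr 1; ring
  rw [Finset.sum_add_distrib, Finset.sum_const, ← Finset.sum_mul, ← Finset.mul_sum, hsq, hpow,
    negLapRegNewton, show -(n + 3 : ℝ) / 2 = e - 2 by rw [he]; ring, Finset.card_univ,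
    Fintype.card_fin, nsmul_eq_mul, Nat.cast_add_one, he]
  ring

theorem integral_comp_fold_mul_negLapRegNewton {φ : HalfAmbient n → ℝ} (hφ : ContDiff ℝ ∞ φ)
    (hc : HasCompactSupport φ) (hb : ∀ X, height X = 0 → fderiv ℝ φ X (eLast n) = 0)
    (X : HalfAmbient n) {c : ℝ} (hc0 : 0 < c) :
    ∫ Y, φ (fold Y) * negLapRegNewton c (Y - X) =
      -∫ Y, (Δ φ) (fold Y) * regNewton c (Y - X) := by
  unfold regNewton
  obtain ⟨e, he⟩ : ∃ e : ℝ, e = (1 - n) / 2 := ⟨_, rfl⟩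
  rw [← he]
  let g' (i : Fin (n + 1)) (Y : HalfAmbient n) : ℝ :=
    2 * e * (Y - X) i * (‖Y - X‖ ^ 2 + c) ^ (e - 1)
  let g'' (i : Fin (n + 1)) (Y : HalfAmbient n) : ℝ :=
    2 * e * (‖Y - X‖ ^ 2 + c) ^ (e - 1) +
      4 * e * (e - 1) * (Y - X) i ^ 2 * (‖Y - X‖ ^ 2 + c) ^ (e - 2)
  have hg := continuous_norm_sq_add_rpow X hc0 e
  have hg' (i) : Continuous (g' i) := by fun_prop (disch := assumption)
  have hg'' (i) : Continuous (g'' i) := by fun_prop (disch := assumption)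
  have hφ₂ (i) := contDiff_coordDeriv (contDiff_coordDeriv hφ i) i
  have hc₂ (i) := hasCompactSupport_coordDeriv (hasCompactSupport_coordDeriv hc i) i
  have hsum (Y : HalfAmbient n) : φ (fold Y) * negLapRegNewton c (Y - X) =
      -∑ i, φ (fold Y) * g'' i Y := by
    rw [← Finset.mul_sum, sum_coord_norm_sq_add_rpow X Y hc0 he, mul_neg, neg_neg]
  simp_rw [hsum, laplacian_eq_sum_coordDeriv hφ, Finset.sum_mul]
  rw [integral_neg,
    integral_finsetSum _ fun i _ => integrable_comp_fold_mul hφ.continuous hc (hg'' i),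
    integral_finsetSum _ fun i _ => integrable_comp_fold_mul (hφ₂ i).continuous (hc₂ i) hg]
  refine congrArg Neg.neg (Finset.sum_congr rfl fun i _ => ?_)
  exact integral_comp_fold_mul_eq_integral_coordDeriv_comp_fold_mul hφ hc hb i hg (hg' i) (hg'' i)
    (hasLineDerivAt_norm_sq_add_rpow X · hc0 e i)
    (hasLineDerivAt_coord_mul_norm_sq_add_rpow X · hc0 e i)

theorem integral_mul_negLapRegNewton_eq (f : HalfAmbient n → ℝ) (X : HalfAmbient n) {ε : ℝ}
    (hε : 0 < ε) :
    ∫ Y, f Y * negLapRegNewton (ε ^ 2) (Y - X) = ∫ Z, f (X + ε • Z) * negLapRegNewton 1 Z := by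
  have hscale (Z : HalfAmbient n) :
      negLapRegNewton (ε ^ 2) (ε • Z) * ε ^ (n + 1) = negLapRegNewton 1 Z := by
    have hnorm : ‖ε • Z‖ ^ 2 + ε ^ 2 = ε ^ 2 * (‖Z‖ ^ 2 + 1) := by
      rw [norm_smul, Real.norm_of_nonneg hε.le]; ring
    have hpow : (ε ^ 2) ^ (-(n + 3 : ℝ) / 2) * (ε ^ 2 * ε ^ (n + 1)) = 1 := by
      rw [← Real.rpow_natCast ε 2, ← Real.rpow_mul hε.le, ← Real.rpow_natCast ε (n + 1),
        ← Real.rpow_add hε, ← Real.rpow_add hε]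
      convert Real.rpow_zero ε using 2
      push_cast
      ring
    rw [negLapRegNewton, negLapRegNewton, hnorm, Real.mul_rpow (by positivity) (by positivity)]
    linear_combination ((n - 1) * (n + 1) * (‖Z‖ ^ 2 + 1) ^ (-(n + 3 : ℝ) / 2)) * hpow
  have hsmul := Measure.integral_comp_smul (volume : Measure (HalfAmbient n))
    (fun W => f (X + W) * negLapRegNewton (ε ^ 2) W) ε
  have hpos : 0 < ε ^ (n + 1) := by positivity
  rw [finrank_euclideanSpace_fin, abs_of_pos (by positivity), smul_eq_mul, inv_mul_eq_div,
    eq_div_iff hpos.ne', ← integral_mul_const] at hsmul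
  rw [← integral_add_left_eq_self _ X]
  simp_rw [add_sub_cancel_left, ← hsmul, mul_assoc, hscale]

theorem negLapRegNewton_one_pos (hn : 2 ≤ n) (Z : HalfAmbient n) : 0 < negLapRegNewton 1 Z := by
  have : (1 : ℝ) < n := by exact_mod_cast hn
  have : (0 : ℝ) < n - 1 := by linarith
  unfold negLapRegNewton
  positivity

theorem integrable_negLapRegNewton_one : Integrable (negLapRegNewton 1 : HalfAmbient n → ℝ) := by
  unfold negLapRegNewton
  simp_rw [add_comm (‖_‖ ^ 2) (1 : ℝ)]
  exact (integrable_rpow_neg_one_add_norm_sq (by rw [finrank_halfAmbient]; linarith)).const_mul _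

theorem integral_negLapRegNewton_one_pos (hn : 2 ≤ n) :
    0 < ∫ Z : HalfAmbient n, negLapRegNewton 1 Z := by
  have hsupport : Function.support (negLapRegNewton 1 : HalfAmbient n → ℝ) = Set.univ :=
    Set.eq_univ_of_forall fun Z => (negLapRegNewton_one_pos hn Z).ne'
  rw [integral_pos_iff_support_of_nonneg (fun Z => (negLapRegNewton_one_pos hn Z).le)
    integrable_negLapRegNewton_one, hsupport]
  exact isOpen_univ.measure_pos _ Set.univ_nonempty

theorem regNewton_le_of_norm_le (hn : 1 ≤ n) {c : ℝ} (hc : 0 < c) {Z W : HalfAmbient n}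
    (h : ‖W‖ ≤ ‖Z‖) : regNewton c Z ≤ regNewton c W := by
  have : (1 : ℝ) ≤ n := by exact_mod_cast hn
  exact Real.rpow_le_rpow_of_nonpos (by positivity) (by gcongr) (by linarith)

theorem regNewton_le_rpow (hn : 1 ≤ n) {c : ℝ} (hc : 0 ≤ c) {Z : HalfAmbient n} (hZ : Z ≠ 0) :
    regNewton c Z ≤ ‖Z‖ ^ (2 - (n + 1 : ℝ)) := by
  have : (1 : ℝ) ≤ n := by exact_mod_cast hn
  have : 0 < ‖Z‖ := norm_pos_iff.2 hZ
  rw [show (2 - (n + 1 : ℝ)) = 2 * ((1 - n : ℝ) / 2) by ring, Real.rpow_mul (norm_nonneg _),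
    Real.rpow_two]
  exact Real.rpow_le_rpow_of_nonpos (by positivity) (by linarith) (by linarith)

theorem enorm_integral_comp_fold_mul_regNewton_le (hn : 1 ≤ n) (f : HalfAmbient n → ℝ)
    {X : HalfAmbient n} (hX : 0 ≤ height X) {c : ℝ} (hc : 0 < c) :
    ‖∫ Y, f (fold Y) * regNewton c (Y - X)‖ₑ ≤
      2 * ∫⁻ Y in halfSpace n, ENNReal.ofReal (‖X - Y‖ ^ (2 - (n + 1 : ℝ))) * ‖f Y‖ₑ := by
  let H (Y : HalfAmbient n) : ℝ≥0∞ := ENNReal.ofReal (regNewton c (Y - X)) * ‖f Y‖ₑ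
  calc ‖∫ Y, f (fold Y) * regNewton c (Y - X)‖ₑ
      ≤ ∫⁻ Y, ‖f (fold Y) * regNewton c (Y - X)‖ₑ := enorm_integral_le_lintegral_enorm _
    _ ≤ ∫⁻ Y, H (fold Y) := by
        refine lintegral_mono fun Y => ?_
        rw [enorm_mul, mul_comm, Real.enorm_of_nonneg (by unfold regNewton; positivity)]
        dsimp only [H]
        gcongr ENNReal.ofReal ?_ * _
        exact regNewton_le_of_norm_le hn hc (norm_fold_sub_le hX Y)
    _ ≤ 2 * ∫⁻ Y in halfSpace n, H Y := lintegral_comp_fold_le H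
    _ ≤ 2 * ∫⁻ Y in halfSpace n, ENNReal.ofReal (‖X - Y‖ ^ (2 - (n + 1 : ℝ))) * ‖f Y‖ₑ := by
        gcongr 2 * ?_
        have hne : ∀ᵐ Y ∂(volume.restrict (halfSpace n)), Y ≠ X :=
          ae_restrict_of_ae (measure_eq_zero_iff_ae_notMem.1 (measure_singleton X))
        refine lintegral_mono_ae ?_
        filter_upwards [hne] with Y hY
        rw [norm_sub_rev X Y]
        gcongr ENNReal.ofReal ?_ * _
        exact regNewton_le_rpow hn hc.le (sub_ne_zero.2 hY)

theorem tendsto_integral_comp_add_smul_mul {f k : HalfAmbient n → ℝ} (hf : Continuous f)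
    {M : ℝ} (hM : ∀ Y, ‖f Y‖ ≤ M) (hk : Integrable k) (X : HalfAmbient n) :
    Tendsto (fun ε : ℝ => ∫ Z, f (X + ε • Z) * k Z) (𝓝 0) (𝓝 (f X * ∫ Z, k Z)) := by
  rw [← integral_const_mul]
  refine tendsto_integral_filter_of_dominated_convergence (fun Z => M * ‖k Z‖)
    (.of_forall fun ε => ?_) (.of_forall fun ε => .of_forall fun Z => ?_)
    (hk.norm.const_mul M) (.of_forall fun Z => ?_)
  · exact (Continuous.aestronglyMeasurable (by fun_prop)).mul hk.aestronglyMeasurable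
  · rw [norm_mul]
    gcongr
    exact hM _
  · have hcont : Continuous fun ε : ℝ => f (X + ε • Z) * k Z := by fun_prop
    simpa using hcont.tendsto 0

theorem exists_enorm_le_riesz_two (hn : 2 ≤ n) : ∃ c : ℝ≥0∞, c ≠ ⊤ ∧ ∀ φ : HalfAmbient n → ℝ,
    ContDiff ℝ ∞ φ → HasCompactSupport φ →
    (∀ X, height X = 0 → fderiv ℝ φ X (eLast n) = 0) →
    ∀ X ∈ halfSpace n, ‖φ X‖ₑ ≤
      c * ∫⁻ Y in halfSpace n, ENNReal.ofReal (‖X - Y‖ ^ (2 - (n + 1 : ℝ))) * ‖(Δ φ) Y‖ₑ := by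
  obtain ⟨c₀, hc₀⟩ : ∃ c₀ : ℝ, c₀ = ∫ Z : HalfAmbient n, negLapRegNewton 1 Z := ⟨_, rfl⟩
  have hc₀pos : 0 < c₀ := hc₀ ▸ integral_negLapRegNewton_one_pos hn
  have hc₀ne : ENNReal.ofReal c₀ ≠ 0 := by simpa using hc₀pos
  refine ⟨2 / ENNReal.ofReal c₀, ENNReal.div_ne_top (by simp) hc₀ne,
    fun φ hφ hc hb X (hX : 0 < height X) => ?_⟩
  have hbound {ε : ℝ} (hε : 0 < ε) : ‖∫ Z, φ (fold (X + ε • Z)) * negLapRegNewton 1 Z‖ₑ ≤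
      2 * ∫⁻ Y in halfSpace n, ENNReal.ofReal (‖X - Y‖ ^ (2 - (n + 1 : ℝ))) * ‖(Δ φ) Y‖ₑ := by
    rw [← integral_mul_negLapRegNewton_eq (fun Y => φ (fold Y)) X hε,
      integral_comp_fold_mul_negLapRegNewton hφ hc hb X (by positivity), enorm_neg]
    exact enorm_integral_comp_fold_mul_regNewton_le (by lia) _ hX.le (by positivity)
  have hlim : Tendsto (fun ε : ℝ => ∫ Z, φ (fold (X + ε • Z)) * negLapRegNewton 1 Z) (𝓝 0)
      (𝓝 (φ X * c₀)) := by
    obtain ⟨M, hM⟩ := hφ.continuous.bounded_above_of_compact_support hc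
    simpa only [Function.comp_apply, fold_of_nonneg hX.le, ← hc₀] using
      tendsto_integral_comp_add_smul_mul (hφ.continuous.comp continuous_fold) (fun Y => hM (fold Y))
        integrable_negLapRegNewton_one X
  have hle : ‖φ X * c₀‖ₑ ≤
      2 * ∫⁻ Y in halfSpace n, ENNReal.ofReal (‖X - Y‖ ^ (2 - (n + 1 : ℝ))) * ‖(Δ φ) Y‖ₑ :=
    le_of_tendsto (hlim.mono_left nhdsWithin_le_nhds).enorm
      (eventually_mem_nhdsWithin.mono fun ε (hε : ε ∈ Set.Ioi 0) => hbound hε)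
  rw [enorm_mul, Real.enorm_of_nonneg hc₀pos.le] at hle
  rwa [← ENNReal.mul_div_right_comm,
    ENNReal.le_div_iff_mul_le (Or.inl hc₀ne) (Or.inl ENNReal.ofReal_ne_top)]

end SecondOrder

section IteratedLaplacian

variable {n : ℕ}

theorem lapPow_succ (k : ℕ) (f : HalfAmbient n → ℝ) : lapPow (k + 1) f = Δ (lapPow k f) :=
  Function.iterate_succ_apply' _ _ _

theorem contDiff_laplacian {f : HalfAmbient n → ℝ} (hf : ContDiff ℝ ∞ f) : ContDiff ℝ ∞ (Δ f) := by
  rw [funext (laplacian_eq_sum_coordDeriv hf)]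
  exact ContDiff.sum fun i _ => contDiff_coordDeriv (contDiff_coordDeriv hf i) i

theorem contDiff_lapPow (k : ℕ) {f : HalfAmbient n → ℝ} (hf : ContDiff ℝ ∞ f) :
    ContDiff ℝ ∞ (lapPow k f) := by
  induction k with
  | zero => exact hf
  | succ k ih => rw [lapPow_succ]; exact contDiff_laplacian ih

theorem hasCompactSupport_lapPow (k : ℕ) {f : HalfAmbient n → ℝ} (hf : HasCompactSupport f) :
    HasCompactSupport (lapPow k f) :=
  HasCompactSupport.intro hf.isCompact fun _ hX =>
    (lapPow_eventuallyEq_zero k (notMem_tsupport_iff_eventuallyEq.mp hX)).eq_of_nhds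

theorem IsTest.mono {r s : ℕ} (hrs : r ≤ s) {φ : HalfAmbient n → ℝ} (h : IsTest s φ) : IsTest r φ :=
  ⟨h.smooth, h.compact, fun j hj => h.neumann j (hj.trans_le hrs)⟩

theorem IsTest.fderiv_lapPow_eq_zero {r j : ℕ} {φ : HalfAmbient n → ℝ} (h : IsTest r φ) (hj : j < r)
    {X : HalfAmbient n} (hX : height X = 0) : fderiv ℝ (lapPow j φ) X (eLast n) = 0 := by
  have hcont : Continuous fun t : ℝ => fderiv ℝ (lapPow j φ) (X + t • eLast n) (eLast n) := by
    have := (contDiff_lapPow j h.smooth).continuous_fderiv (by simp)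
    fun_prop
  have hlim := hcont.tendsto 0
  simp only [zero_smul, add_zero] at hlim
  exact tendsto_nhds_unique (hlim.mono_left nhdsWithin_le_nhds) (h.neumann j hj X hX)

end IteratedLaplacian

section TestFunctions

variable {n : ℕ} {m x y a b : ℝ}

theorem RieszCond.order_pos (h : RieszCond n m x y a b) : 0 < m := by
  have : ((n : ℝ) + 1) * y < (n + 1) * x := by gcongr; exact h.lt
  linarith [h.scaling, h.le]

theorem RieszCond.interpolate (h : RieszCond n m x y a b) {σ τ : ℝ} (hσ : 0 ≤ σ) (hστ : σ < τ)
    (hτ : τ ≤ 1) :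
    RieszCond n ((τ - σ) * m) (AffineMap.lineMap x y σ) (AffineMap.lineMap x y τ)
      (AffineMap.lineMap a b σ) (AffineMap.lineMap a b τ) := by
  obtain ⟨hy, hyx, hx, hab, hb, ha, hscaling⟩ := h
  simp only [AffineMap.lineMap_apply_ring']
  exact ⟨by nlinarith, by nlinarith, by nlinarith, by nlinarith, by nlinarith, by nlinarith,
    by linear_combination (τ - σ) * hscaling⟩

theorem exists_wInt_le_lapPow (h : RieszCond n m x y a b) (hmn : m < n + 1) (j : ℕ) {σ : ℝ}
    (hσ : 0 ≤ σ) (hj : (1 - σ) * m = 2 * j) :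
    ∃ C : ℝ≥0∞, C ≠ ⊤ ∧ ∀ φ : HalfAmbient n → ℝ, IsTest j φ →
      wInt (b / y) (1 / y) φ ^ y ≤
        C * wInt (AffineMap.lineMap a b σ / AffineMap.lineMap x y σ)
          (1 / AffineMap.lineMap x y σ) (lapPow j φ) ^ AffineMap.lineMap x y σ := by
  have hm := h.order_pos
  induction j generalizing σ with
  | zero =>
    obtain rfl : σ = 1 := by
      rcases mul_eq_zero.1 (hj.trans (by simp)) with hσ1 | hm0
      · linarith
      · exact absurd hm0 hm.ne'
    exact ⟨1, ENNReal.one_ne_top, fun φ _ => by simp [lapPow]⟩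
  | succ j ih =>
    push_cast at hj
    have hstep : (σ + 2 / m - σ) * m = 2 := by field_simp; ring
    have hj' : (1 - (σ + 2 / m)) * m = 2 * j := by linear_combination hj - hstep
    have hτ : σ + 2 / m ≤ 1 := by
      by_contra! hcon
      nlinarith [(Nat.cast_nonneg j : (0 : ℝ) ≤ j)]
    have hn : 2 ≤ n := by
      have : (1 : ℝ) < n := by nlinarith [(Nat.cast_nonneg j : (0 : ℝ) ≤ j)]
      exact_mod_cast this
    obtain ⟨C, hC, hlow⟩ := ih (by positivity) hj'
    obtain ⟨c, hc, hriesz⟩ := exists_enorm_le_riesz_two hn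
    have hcond := h.interpolate hσ (lt_add_of_pos_right σ (by positivity)) hτ
    rw [hstep] at hcond
    obtain ⟨C', hC', hhigh⟩ := hcond.exists_wInt_le (by nlinarith) hc
    refine ⟨C * C', ENNReal.mul_ne_top hC hC', fun φ hφ => ?_⟩
    have hsmooth := contDiff_lapPow j hφ.smooth
    refine (hlow φ (hφ.mono (by simp))).trans ?_
    rw [mul_assoc, lapPow_succ]
    gcongr
    exact hhigh (lapPow j φ) _ (contDiff_laplacian hsmooth).continuous.enorm.measurable
      (hriesz (lapPow j φ) hsmooth (hasCompactSupport_lapPow j hφ.compact)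
        fun Z hZ => hφ.fderiv_lapPow_eq_zero (by simp) hZ)

theorem exists_wInt_le_lapPow_even {k : ℕ} (h : RieszCond n (2 * k : ℕ) x y a b)
    (hmn : ((2 * k : ℕ) : ℝ) < n + 1) :
    ∃ C : ℝ≥0∞, C ≠ ⊤ ∧ ∀ φ : HalfAmbient n → ℝ, IsTest k φ →
      wInt (b / y) (1 / y) φ ^ y ≤ C * wInt (a / x) (1 / x) (lapPow k φ) ^ x := by
  simpa using exists_wInt_le_lapPow h hmn k le_rfl (by simp)

theorem exists_wInt_le_gradient_lapPow_odd {k : ℕ} (h : RieszCond n (2 * k + 1 : ℕ) x y a b)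
    (hmn : ((2 * k + 1 : ℕ) : ℝ) < n + 1) :
    ∃ C : ℝ≥0∞, C ≠ ⊤ ∧ ∀ φ : HalfAmbient n → ℝ, IsTest k φ →
      wInt (b / y) (1 / y) φ ^ y ≤ C * wInt (a / x) (1 / x) (∇ (lapPow k φ)) ^ x := by
  set σ : ℝ := 1 / (2 * k + 1 : ℕ)
  have hσ : 0 < σ := by positivity
  have hσ1 : σ ≤ 1 := (div_le_one (by positivity)).2 (by simp)
  have hstep : (σ - 0) * (2 * k + 1 : ℕ) = 1 := by simp only [σ]; field_simp; ring
  have hmn1 : (1 : ℝ) < n + 1 := by push_cast at hmn; linarith [(Nat.cast_nonneg k : (0 : ℝ) ≤ k)]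
  obtain ⟨C, hC, hlow⟩ := exists_wInt_le_lapPow h hmn k hσ.le (by
    push_cast at hstep ⊢; linear_combination -hstep)
  obtain ⟨c, hc, hriesz⟩ := exists_enorm_le_riesz_one n
  have hcond := h.interpolate le_rfl hσ hσ1
  rw [hstep, AffineMap.lineMap_apply_zero, AffineMap.lineMap_apply_zero] at hcond
  obtain ⟨C', hC', hhigh⟩ := hcond.exists_wInt_le hmn1 hc
  refine ⟨C * C', ENNReal.mul_ne_top hC hC', fun φ hφ => (hlow φ hφ).trans ?_⟩
  have hsmooth := contDiff_lapPow k hφ.smooth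
  have hmeas : Measurable fun X => ‖∇ (lapPow k φ) X‖ₑ := by
    simp_rw [enorm_gradient]
    exact (hsmooth.continuous_fderiv (by simp)).enorm.measurable
  rw [mul_assoc]
  gcongr
  exact hhigh (lapPow k φ) _ hmeas
    (hriesz (lapPow k φ) (hsmooth.of_le (by simp)) (hasCompactSupport_lapPow k hφ.compact))

end TestFunctions

section Exponents

variable {n m : ℕ} {p a b : ℝ}

theorem ExpCond.pos (h : ExpCond n m p a b) : 0 < p := one_pos.trans h.one_lt

theorem ExpCond.critExp_pos (h : ExpCond n m p a b) : 0 < critExp n m p a b :=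
  h.pos.trans h.lt_critExp

theorem ExpCond.critExp_mul (h : ExpCond n m p a b) :
    critExp n m p a b * (n + 1 + a - m * p) = p * (n + 1 + b) := by
  have hden : (n : ℝ) + 1 + a - m * p ≠ 0 := fun hzero =>
    h.critExp_pos.ne' (by rw [critExp, hzero, div_zero])
  rw [critExp, div_mul_cancel₀ _ hden]

theorem ExpCond.rieszCond (h : ExpCond n m p a b) (hmp : m * p < n + 1) :
    RieszCond n m (1 / p) (1 / critExp n m p a b) (a / p) (b / critExp n m p a b) := by
  have hp := h.pos
  have hq := h.critExp_pos
  have hqD := h.critExp_mul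
  obtain ⟨hp1, hpq, -, ha, hb, hba⟩ := h
  set q := critExp n m p a b
  have hN : (0 : ℝ) < n + 1 + b := by linarith [(Nat.cast_nonneg n : (0 : ℝ) ≤ n)]
  have hD : 0 < n + 1 + a - m * p := pos_of_mul_pos_right (hqD ▸ mul_pos hp hN) hq.le
  have hweights : b * p ≤ a * q := by
    refine le_of_mul_le_mul_right ?_ hD
    have := (le_div_iff₀ (by linarith)).1 hba
    calc b * p * (n + 1 + a - m * p) ≤ a * (p * (n + 1 + b)) := by nlinarith
      _ = a * q * (n + 1 + a - m * p) := by rw [← hqD]; ring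
  refine ⟨by positivity, one_div_lt_one_div_of_lt hp hpq, (div_lt_one hp).2 hp1,
    (div_le_div_iff₀ hq hp).2 hweights, ?_, ?_, ?_⟩
  · rw [← neg_div]
    gcongr
  · rw [lt_sub_iff_add_lt, ← add_div, div_lt_one hp]
    linarith
  · field_simp
    linear_combination hqD

theorem ExpCond.order_lt (h : ExpCond n m p a b) (hmp : m * p < n + 1) : (m : ℝ) < n + 1 :=
  (le_mul_of_one_le_right (Nat.cast_nonneg m) h.one_lt.le).trans_lt hmp

theorem rpow_div_le_of_rpow_one_div_le {A B C : ℝ≥0∞} {p q : ℝ} (hp : 0 < p)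
    (h : A ^ (1 / q) ≤ C * B ^ (1 / p)) : A ^ (p / q) ≤ C ^ p * B := by
  calc A ^ (p / q) = (A ^ (1 / q)) ^ p := by rw [← ENNReal.rpow_mul, one_div_mul_eq_div]
    _ ≤ (C * B ^ (1 / p)) ^ p := ENNReal.rpow_le_rpow h hp.le
    _ = C ^ p * B := by
      rw [ENNReal.mul_rpow_of_nonneg _ _ hp.le, one_div, ENNReal.rpow_inv_rpow hp.ne']

theorem ExpCond.exists_wInt_le_lapPow {k : ℕ} (h : ExpCond n (2 * k) p a b)
    (hmp : (2 * k : ℕ) * p < n + 1) :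
    ∃ C : ℝ≥0∞, C ≠ ⊤ ∧ ∀ φ : HalfAmbient n → ℝ, IsTest k φ →
      wInt b (critExp n (2 * k) p a b) φ ^ (p / critExp n (2 * k) p a b) ≤
        C * wInt a p (lapPow k φ) := by
  obtain ⟨C, hC, hbound⟩ := exists_wInt_le_lapPow_even (h.rieszCond hmp) (h.order_lt hmp)
  simp only [div_div_div_cancel_right₀ h.critExp_pos.ne', div_div_div_cancel_right₀ h.pos.ne',
    one_div_one_div, div_one] at hbound
  exact ⟨C ^ p, ENNReal.rpow_ne_top_of_nonneg h.pos.le hC,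
    fun φ hφ => rpow_div_le_of_rpow_one_div_le h.pos (hbound φ hφ)⟩

theorem ExpCond.exists_wInt_le_gradient_lapPow {k : ℕ} (h : ExpCond n (2 * k + 1) p a b)
    (hmp : (2 * k + 1 : ℕ) * p < n + 1) :
    ∃ C : ℝ≥0∞, C ≠ ⊤ ∧ ∀ φ : HalfAmbient n → ℝ, IsTest k φ →
      wInt b (critExp n (2 * k + 1) p a b) φ ^ (p / critExp n (2 * k + 1) p a b) ≤
        C * wInt a p (∇ (lapPow k φ)) := by
  obtain ⟨C, hC, hbound⟩ := exists_wInt_le_gradient_lapPow_odd (h.rieszCond hmp) (h.order_lt hmp)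
  simp only [div_div_div_cancel_right₀ h.critExp_pos.ne', div_div_div_cancel_right₀ h.pos.ne',
    one_div_one_div, div_one] at hbound
  exact ⟨C ^ p, ENNReal.rpow_ne_top_of_nonneg h.pos.le hC,
    fun φ hφ => rpow_div_le_of_rpow_one_div_le h.pos (hbound φ hφ)⟩

end Exponents

theorem setLIntegral_le_of_forall_isCompact {X : Type*} [TopologicalSpace X] [T2Space X]
    [MeasurableSpace X] {μ : Measure X} {s : Set X} (hs : IsSigmaCompact s) {f : X → ℝ≥0∞}
    {B : ℝ≥0∞} (hB : ∀ K ⊆ s, IsCompact K → ∫⁻ x in K, f x ∂μ ≤ B) : ∫⁻ x in s, f x ∂μ ≤ B := by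
  obtain ⟨K, hK, rfl⟩ := hs
  rw [← Set.iUnion_accumulate,
    setLIntegral_iUnion_of_directed _ Set.monotone_accumulate.directed_le]
  exact iSup_le fun i => hB _ (Set.accumulate_subset_iUnion i) (isCompact_accumulate hK i)

theorem ae_eq_of_forall_integral_smul_eq {E V : Type*} [NormedAddCommGroup E] [NormedSpace ℝ E]
    [FiniteDimensional ℝ E] [MeasurableSpace E] [BorelSpace E] {μ : Measure E}
    [NormedAddCommGroup V] [NormedSpace ℝ V] [CompleteSpace V] {U : Set E} (hU : IsOpen U)
    {F G : E → V} (hF : LocallyIntegrableOn F U μ) (hG : LocallyIntegrableOn G U μ)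
    (h : ∀ ψ : E → ℝ, ContDiff ℝ ∞ ψ → HasCompactSupport ψ → tsupport ψ ⊆ U →
      ∫ X in U, ψ X • F X ∂μ = ∫ X in U, ψ X • G X ∂μ) :
    ∀ᵐ X ∂μ, X ∈ U → F X = G X := by
  refine (hU.ae_eq_zero_of_integral_contDiff_smul_eq_zero (hF.sub hG) fun ψ hψ hc hsub => ?_).mono
    fun X hX hmem => sub_eq_zero.1 (hX hmem)
  have hzero : ∀ (H : E → V), ∀ X ∉ tsupport ψ, ψ X • H X = 0 := fun H X hX => by
    rw [image_eq_zero_of_notMem_tsupport hX, zero_smul]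
  have hint : ∀ {H : E → V}, LocallyIntegrableOn H U μ → Integrable (fun X => ψ X • H X) μ :=
    fun {H} hH => (integrableOn_iff_integrable_of_support_subset
      (Function.support_subset_iff'.2 (hzero H))).1
      ((hH.integrableOn_compact_subset hsub hc.isCompact).continuousOn_smul
        hψ.continuous.continuousOn hc.isCompact)
  have hglobal : ∀ H : E → V, ∫ X in U, ψ X • H X ∂μ = ∫ X, ψ X • H X ∂μ := fun H =>
    setIntegral_eq_integral_of_forall_compl_eq_zero fun X hX => hzero H X fun hXs => hX (hsub hXs)
  simp only [Pi.sub_apply, smul_sub]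
  rw [integral_sub (hint hF) (hint hG), ← hglobal, ← hglobal, h ψ hψ hc hsub, sub_self]

theorem setLIntegral_mul_enorm_rpow_le_liminf {X : Type*} [MeasurableSpace X] {μ : Measure X}
    {w : X → ℝ≥0∞} (hw : Measurable w) (hw_top : ∀ x, w x ≠ ⊤) (q : ℝ) {f : ℕ → X → ℝ} {g : X → ℝ}
    (hf : ∀ i, Measurable (f i)) (hlim : ∀ᵐ x ∂μ, Tendsto (fun i => f i x) atTop (𝓝 (g x))) :
    ∫⁻ x, w x * ‖g x‖ₑ ^ q ∂μ ≤ liminf (fun i => ∫⁻ x, w x * ‖f i x‖ₑ ^ q ∂μ) atTop := by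
  calc ∫⁻ x, w x * ‖g x‖ₑ ^ q ∂μ
      = ∫⁻ x, liminf (fun i => w x * ‖f i x‖ₑ ^ q) atTop ∂μ := by
        refine lintegral_congr_ae (hlim.mono fun x hx => (Tendsto.liminf_eq ?_).symm)
        exact ENNReal.Tendsto.const_mul ((ENNReal.continuous_rpow_const.tendsto _).comp hx.enorm)
          (Or.inr (hw_top x))
    _ ≤ liminf (fun i => ∫⁻ x, w x * ‖f i x‖ₑ ^ q ∂μ) atTop :=
        lintegral_liminf_le fun i => by have := hf i; fun_prop

section Density

variable {n : ℕ}

theorem isSigmaCompact_halfSpace : IsSigmaCompact (halfSpace n) := by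
  have : LocallyCompactSpace (halfSpace n) := isOpen_halfSpace.locallyCompactSpace
  exact isSigmaCompact_iff_sigmaCompactSpace.2 inferInstance

theorem wInt_congr {V : Type*} [NormedAddCommGroup V] {a q : ℝ} {F G : HalfAmbient n → V}
    (h : ∀ᵐ X, X ∈ halfSpace n → F X = G X) : wInt a q F = wInt a q G :=
  lintegral_congr_ae <| ((ae_restrict_iff' measurableSet_halfSpace).2 h).mono fun X hX => by
    simp only [hX]

theorem wInt_le_of_tendstoL1Loc {b q : ℝ} {φ : ℕ → HalfAmbient n → ℝ}
    {u : HalfAmbient n → ℝ} (hφ : ∀ i, Continuous (φ i)) (hu : LocallyIntegrableOn u (halfSpace n))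
    (hlim : TendstoL1Loc φ u) {B : ℕ → ℝ≥0∞} {B₀ : ℝ≥0∞} (hB : ∀ i, wInt b q (φ i) ≤ B i)
    (hB₀ : Tendsto B atTop (𝓝 B₀)) : wInt b q u ≤ B₀ := by
  refine setLIntegral_le_of_forall_isCompact isSigmaCompact_halfSpace fun K hKs hK => ?_
  have hmeasure : TendstoInMeasure (volume.restrict K) φ atTop u :=
    tendstoInMeasure_of_tendsto_eLpNorm one_ne_zero (fun i => (hφ i).aestronglyMeasurable)
      (hu.integrableOn_compact_subset hKs hK).aestronglyMeasurable
      (by simpa only [eLpNorm_one_eq_lintegral_enorm, Pi.sub_apply] using hlim K hK hKs)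
  obtain ⟨ns, hns, hae⟩ := hmeasure.exists_seq_tendsto_ae
  calc ∫⁻ X in K, ENNReal.ofReal (height X ^ b) * ‖u X‖ₑ ^ q
      ≤ liminf (fun i => ∫⁻ X in K, ENNReal.ofReal (height X ^ b) * ‖φ (ns i) X‖ₑ ^ q) atTop :=
        setLIntegral_mul_enorm_rpow_le_liminf (by fun_prop) (fun _ => ENNReal.ofReal_ne_top) q
          (fun i => (hφ (ns i)).measurable) hae
    _ ≤ liminf (fun i => B (ns i)) atTop := liminf_le_liminf (Eventually.of_forall fun i =>
        (lintegral_mono_set hKs).trans (hB (ns i)))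
    _ = B₀ := (hB₀.comp hns.tendsto_atTop).liminf_eq

theorem wInt_le_add {V : Type*} [NormedAddCommGroup V] {a p : ℝ} (hp : 1 ≤ p)
    {F G : HalfAmbient n → V} (hG : LocallyIntegrableOn G (halfSpace n)) :
    wInt a p F ≤ 2 ^ (p - 1) * (wInt a p (fun X => F X - G X) + wInt a p G) := by
  have : AEMeasurable (fun X => ‖G X‖ₑ) (volume.restrict (halfSpace n)) :=
    hG.aestronglyMeasurable.enorm
  unfold wInt
  rw [← lintegral_add_right' _ (by fun_prop),
    ← lintegral_const_mul' _ _ (ENNReal.rpow_ne_top_of_nonneg (by linarith) ENNReal.ofNat_ne_top)]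
  refine lintegral_mono fun X => ?_
  calc ENNReal.ofReal (height X ^ a) * ‖F X‖ₑ ^ p
      ≤ ENNReal.ofReal (height X ^ a) * (2 ^ (p - 1) * (‖F X - G X‖ₑ ^ p + ‖G X‖ₑ ^ p)) := by
        gcongr
        refine le_trans ?_ (ENNReal.rpow_add_le_mul_rpow_add_rpow _ _ hp)
        gcongr
        simpa using enorm_add_le (F X - G X) (G X)
    _ = _ := by ring

theorem wInt_rpow_le_of_tendsto {V : Type*} [NormedAddCommGroup V] {p q a b : ℝ} (hp : 1 < p)
    (hq : 0 < q) {C : ℝ≥0∞} (hC : C ≠ ⊤) {φ : ℕ → HalfAmbient n → ℝ} {u : HalfAmbient n → ℝ}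
    {F : ℕ → HalfAmbient n → V} {G : HalfAmbient n → V} (hφ : ∀ i, Continuous (φ i))
    (hφF : ∀ i, wInt b q (φ i) ^ (p / q) ≤ C * wInt a p (F i))
    (hu : LocallyIntegrableOn u (halfSpace n)) (hG : LocallyIntegrableOn G (halfSpace n))
    (hφu : TendstoL1Loc φ u)
    (hFG : Tendsto (fun i => wInt a p (fun X => F i X - G X)) atTop (𝓝 0)) :
    wInt b q u ^ (p / q) ≤ C * 2 ^ (p - 1) * wInt a p G := by
  have hpq : 0 < p / q := by positivity
  set c : ℝ≥0∞ := C * 2 ^ (p - 1)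
  have hc : c ≠ ⊤ := ENNReal.mul_ne_top hC
    (ENNReal.rpow_ne_top_of_nonneg (by linarith) ENNReal.ofNat_ne_top)
  have hbound : ∀ i, wInt b q (φ i) ≤
      (c * (wInt a p (fun X => F i X - G X) + wInt a p G)) ^ (p / q)⁻¹ := fun i => by
    rw [← ENNReal.rpow_le_rpow_iff hpq, ENNReal.rpow_inv_rpow hpq.ne']
    refine (hφF i).trans ?_
    rw [mul_assoc]
    gcongr
    exact wInt_le_add hp.le hG
  have hlim : Tendsto (fun i => (c * (wInt a p (fun X => F i X - G X) + wInt a p G)) ^ (p / q)⁻¹)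
      atTop (𝓝 ((c * (0 + wInt a p G)) ^ (p / q)⁻¹)) :=
    (ENNReal.continuous_rpow_const.tendsto _).comp
      (ENNReal.Tendsto.const_mul (hFG.add tendsto_const_nhds) (Or.inr hc))
  have hle := ENNReal.rpow_le_rpow (wInt_le_of_tendstoL1Loc hφ hu hφu hbound hlim) hpq.le
  rwa [ENNReal.rpow_inv_rpow hpq.ne', zero_add] at hle

end Density

section Completion

variable {n : ℕ}

theorem exists_ofReal_ge {c : ℝ≥0∞} (hc : c ≠ ⊤) : ∃ S : ℝ, 0 < S ∧ c ≤ ENNReal.ofReal S :=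
  ⟨c.toReal + 1, by positivity,
    (ENNReal.le_ofReal_iff_toReal_le hc (by positivity)).2 (by linarith)⟩

theorem weightedSobolev_odd {k : ℕ} {p a b : ℝ} (h : ExpCond n (2 * k + 1) p a b)
    (hmp : (2 * k + 1 : ℕ) * p < n + 1) :
    ∃ S : ℝ, 0 < S ∧ ∀ u : HalfAmbient n → ℝ, MemSobolevOdd k a p u →
      ∀ G : HalfAmbient n → HalfAmbient n, IsWeakGradLap k u G →
        wInt b (critExp n (2 * k + 1) p a b) u ^ (p / critExp n (2 * k + 1) p a b) ≤
          ENNReal.ofReal S * wInt a p G := by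
  obtain ⟨C, hC, htest⟩ := h.exists_wInt_le_gradient_lapPow hmp
  obtain ⟨S, hS, hCS⟩ := exists_ofReal_ge (c := C * 2 ^ (p - 1)) (ENNReal.mul_ne_top hC
    (ENNReal.rpow_ne_top_of_nonneg (by linarith [h.one_lt]) ENNReal.ofNat_ne_top))
  refine ⟨S, hS, fun u ⟨hu, G₀, hG₀, _, φ, hφ, hφu, hφG⟩ G hG => ?_⟩
  rw [wInt_congr (ae_eq_of_forall_integral_smul_eq isOpen_halfSpace hG.locInt hG₀.locInt
    fun ψ hψ hc hsub => by rw [hG.eq ψ hψ hc hsub, hG₀.eq ψ hψ hc hsub])]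
  refine (wInt_rpow_le_of_tendsto h.one_lt h.critExp_pos hC (fun i => (hφ i).smooth.continuous)
    (fun i => htest _ (hφ i)) hu hG₀.locInt hφu hφG).trans ?_
  gcongr

theorem weightedSobolev_even {k : ℕ} {p a b : ℝ} (h : ExpCond n (2 * k) p a b)
    (hmp : (2 * k : ℕ) * p < n + 1) :
    ∃ S : ℝ, 0 < S ∧ ∀ u : HalfAmbient n → ℝ, MemSobolevEven k a p u →
      ∀ g : HalfAmbient n → ℝ, IsWeakLap k u g →
        wInt b (critExp n (2 * k) p a b) u ^ (p / critExp n (2 * k) p a b) ≤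
          ENNReal.ofReal S * wInt a p g := by
  obtain ⟨C, hC, htest⟩ := h.exists_wInt_le_lapPow hmp
  obtain ⟨S, hS, hCS⟩ := exists_ofReal_ge (c := C * 2 ^ (p - 1)) (ENNReal.mul_ne_top hC
    (ENNReal.rpow_ne_top_of_nonneg (by linarith [h.one_lt]) ENNReal.ofNat_ne_top))
  refine ⟨S, hS, fun u ⟨hu, g₀, hg₀, _, φ, hφ, hφu, hφg⟩ g hg => ?_⟩
  rw [wInt_congr (ae_eq_of_forall_integral_smul_eq isOpen_halfSpace hg.locInt hg₀.locInt
    fun ψ hψ hc hsub => by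
      simp only [smul_eq_mul]
      rw [hg.eq ψ hψ hc hsub, hg₀.eq ψ hψ hc hsub])]
  refine (wInt_rpow_le_of_tendsto h.one_lt h.critExp_pos hC (fun i => (hφ i).smooth.continuous)
    (fun i => htest _ (hφ i)) hu hg₀.locInt hφu hφg).trans ?_
  gcongr

end Completion

theorem theorem1p10_general (n m : ℕ) (p α β : ℝ) (hmp : m * p < n + 1)
    (h : ExpCond n m p α β) :
    (Odd m → ∃ C : ℝ, 0 < C ∧ ∀ u : HalfAmbient n → ℝ, MemSobolevOdd ((m - 1) / 2) α p u →
      ∀ G : HalfAmbient n → HalfAmbient n, IsWeakGradLap ((m - 1) / 2) u G →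
        wInt β (critExp n m p α β) u ^ (p / critExp n m p α β) ≤
          ENNReal.ofReal C * wInt α p G) ∧
    (Even m → ∃ C : ℝ, 0 < C ∧ ∀ u : HalfAmbient n → ℝ, MemSobolevEven (m / 2) α p u →
      ∀ g : HalfAmbient n → ℝ, IsWeakLap (m / 2) u g →
        wInt β (critExp n m p α β) u ^ (p / critExp n m p α β) ≤
          ENNReal.ofReal C * wInt α p g) := by
  constructor
  · rintro ⟨k, rfl⟩
    rw [show (2 * k + 1 - 1) / 2 = k by lia]
    exact weightedSobolev_odd h hmp
  · rintro hm
    obtain ⟨k, rfl⟩ := hm.two_dvd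
    rw [show 2 * k / 2 = k by lia]
    exact weightedSobolev_even h hmp

theorem theorem1p10 :
    (∀ (n : ℕ) (p α₁ β₁ : ℝ), 1 ≤ n → p < (n : ℝ) + 1 → ExpCond n 1 p α₁ β₁ →
      ∃ S : ℝ, 0 < S ∧ ∀ u : HalfAmbient n → ℝ, MemSobolevOdd 0 α₁ p u →
        ∀ G : HalfAmbient n → HalfAmbient n, IsWeakGradLap 0 u G →
          wInt β₁ (critExp n 1 p α₁ β₁) u ^ (p / critExp n 1 p α₁ β₁) ≤
            ENNReal.ofReal S * wInt α₁ p G) ∧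
    (∀ (n m : ℕ) (p α β : ℝ), 1 ≤ n → 1 ≤ m → (m : ℝ) * p < n → ExpCond n m p α β →
      (Odd m → ∃ C : ℝ, 0 < C ∧ ∀ u : HalfAmbient n → ℝ, MemSobolevOdd ((m - 1) / 2) α p u →
        ∀ G : HalfAmbient n → HalfAmbient n, IsWeakGradLap ((m - 1) / 2) u G →
          wInt β (critExp n m p α β) u ^ (p / critExp n m p α β) ≤
            ENNReal.ofReal C * wInt α p G) ∧
      (Even m → ∃ C : ℝ, 0 < C ∧ ∀ u : HalfAmbient n → ℝ, MemSobolevEven (m / 2) α p u →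
        ∀ g : HalfAmbient n → ℝ, IsWeakLap (m / 2) u g →
          wInt β (critExp n m p α β) u ^ (p / critExp n m p α β) ≤
            ENNReal.ofReal C * wInt α p g)) :=
  ⟨fun n p α₁ β₁ _ hp h =>
      (theorem1p10_general n 1 p α₁ β₁ (by simpa using hp) h).1 odd_one,
    fun n m p α β _ _ hmp h => theorem1p10_general n m p α β (by linarith) h⟩
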